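/- Let $\Omega=\{(x,y,z)\in\mathbb R^3: x^2+y^2<1,\ 0<z<1\}$, let $B$ be the open unit disc of the $xy$-plane, let $|F|$ be the Euclidean (Frobenius) norm of $F\in\mathbb R^{3\times3}$, and for a weakly differentiable $u:\Omega\to\mathbb R^3$ let $\mathbb E(u)=\tfrac12(\nabla u^T+\nabla u)$. *Loads.* Let $\varphi\in C^2(\overline B)$ be radial with radial profile $\phi$, with $\Delta\varphi\neq0$ at some point of $B$ and $\phi(1)=\phi'(1)=\int_0^1r^2\phi'(r)\,dr=0$. Let $\psi\in C^0([0,1])$ with $\int_0^1\psi(z)\,dz=0$ and $\int_0^1z\psi(z)\,dz>0$. Put $f(x,y,z)=(\varphi_x(x,y),\varphi_y(x,y),\psi(z))$, $\mathcal L(v)=\int_\Omega f\cdot v$, and $\mathcal S^0_{\mathcal L}=\{R\in SO(3):\mathcal L((R-I)\mathbf x)=0\}$, where $\mathbf x$ denotes the identity map of $\Omega$. *Energy density.* Let $p\in(1,2]$ and let $\mathcal W:\mathbb R^{3\times3}\to[0,+\infty]$ be Borel measurable with: $\mathcal W(RF)=\mathcal W(F)$ for all $R\in SO(3)$ and all $F$;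 $\mathcal W(I)=0$; there are an open set $\mathcal U\supset SO(3)$ on which $\mathcal W$ is finite and $C^2$, an increasing $\omega$ on $[0,\infty)$ with $\lim_{t\to0^+}\omega(t)=0$ and a constant $K>0$ such that $|D^2\mathcal W(I)|\le K$ and $|D^2\mathcal W(F)-D^2\mathcal W(G)|\le\omega(|F-G|)$ for $F,G\in\mathcal U$; and for some $C>0$, $\mathcal W(F)\ge C\,g_p(\mathrm{dist}(F,SO(3)))$ for all $F$, where $g_p(t)=t^2$ for $0\le t\le1$ and $g_p(t)=\tfrac{2t^p}{p}-\tfrac2p+1$ for $t\ge1$. Let $\mathcal Q(F)=\tfrac12F^TD^2\mathcal W(I)F$ and assume $\mathcal Q(F)=4|F|^2$ for every symmetric $F\in\mathbb R^{3\times3}$. *Functionals.* For $u\in H^1(\Omega,\mathbb R^3)$ and $\theta\in[-\pi,\pi]$ let $$\mathcal E(u)=\int_\Omega\mathcal Q(\mathbb E(u))-\mathcal L(u),\qquad \mathcal G(u)=\int_\Omega\mathcal Q(\mathbb E(u))-\mathcal L(u)-\max_{R\in\mathcal S^0_{\mathcal L}}\mathcal L((R-I)u),$$ $$\mathcal G_\theta(u)=4\int_\Omega|\mathbb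 E(u)|^2-\mathcal L(R_\theta u),\qquad R_\theta=\begin{pmatrix}\cos\theta&\sin\theta&0\\-\sin\theta&\cos\theta&0\\0&0&1\end{pmatrix},$$ and let all these functionals be $+\infty$ on $W^{1,p}(\Omega,\mathbb R^3)\setminus H^1(\Omega,\mathbb R^3)$. **Proposition 5.3.** The functionals $\mathcal G_0$ and $\mathcal G_{-\pi/2}$ have minimizers over $W^{1,p}(\Omega,\mathbb R^3)$. For all minimizers $u_0$ of $\mathcal G_0$ and $u_{-\pi/2}$ of $\mathcal G_{-\pi/2}$ over $W^{1,p}(\Omega,\mathbb R^3)$, all the minima below are attained, and $$\min_{W^{1,p}(\Omega,\mathbb R^3)}\mathcal G_\theta=\cos^2\theta\;\mathcal G_0(u_0)+\sin^2\theta\;\mathcal G_{-\pi/2}(u_{-\pi/2})\qquad\text{for every }\theta\in[-\pi,\pi],$$ $$\min_{W^{1,p}(\Omega,\mathbb R^3)}\mathcal G=\min_{\theta\in[-\pi,\pi]}\ \min_{u\in W^{1,p}(\Omega,\mathbb R^3)}\mathcal G_\theta(u)=\mathcal G_{-\pi/2}(u_{-\pi/2})<\mathcal G_0(u_0)=\min_{W^{1,p}(\Omega,\mathbb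 R^3)}\mathcal E.$$ -/

import Mathlib

open MeasureTheory Set Filter Topology
open scoped ENNReal ContDiff InnerProductSpace

/-! Matrices carry the Euclidean (Frobenius) norm throughout. -/

open scoped Matrix.Norms.Frobenius

noncomputable section

namespace ElasticGap

/-- The plane. -/
abbrev E2 : Type := EuclideanSpace ℝ (Fin 2)

/-- The three-dimensional space. -/
abbrev E3 : Type := EuclideanSpace ℝ (Fin 3)

/-- Real `3 × 3` matrices. -/
abbrev M3 : Type := Matrix (Fin 3) (Fin 3) ℝ

/-- The set `SO(3)`. -/
def SO3 : Set M3 := (Matrix.specialOrthogonalGroup (Fin 3) ℝ : Set M3)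

/-- The vector field `x ↦ R (v x)`. -/
def matField (R : M3) (v : E3 → E3) : E3 → E3 := fun x => R.toEuclideanLin (v x)

/-! ### Sobolev spaces through weak derivatives -/

/-- `g` is the weak `j`-th partial derivative of the scalar function `v` on the open set `U`. -/
def IsWeakPartial (U : Set E3) (j : Fin 3) (v g : E3 → ℝ) : Prop :=
  LocallyIntegrableOn v U ∧ LocallyIntegrableOn g U ∧
    ∀ χ : E3 → ℝ, ContDiff ℝ ∞ χ → HasCompactSupport χ → tsupport χ ⊆ U →
      ∫ x in U, v x * fderiv ℝ χ x (EuclideanSpace.single j 1) = -∫ x in U, g x * χ x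

open scoped Classical in
/-- The weak `j`-th partial derivative on `U` (unique up to a null subset of `U`), and `0` if there
is none. -/
def weakPartial (U : Set E3) (j : Fin 3) (v : E3 → ℝ) : E3 → ℝ :=
  if h : ∃ g, IsWeakPartial U j v g then Classical.choose h else 0

/-- The Sobolev space `W^{1,q}(U, ℝ³)`, as a set of representatives. -/
def W1 (U : Set E3) (q : ℝ≥0∞) : Set (E3 → E3) :=
  {u | ∀ i, MemLp (fun x => u x i) q (volume.restrict U) ∧
    ∀ j, ∃ g, MemLp g q (volume.restrict U) ∧ IsWeakPartial U j (fun x => u x i) g}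

/-- The weak gradient of a vector field: entry `(i, j)` is the `j`-th derivative of `u_i`. -/
def weakGrad (U : Set E3) (u : E3 → E3) (x : E3) : M3 :=
  Matrix.of fun i j => weakPartial U j (fun y => u y i) x

/-- The linearized strain: the symmetric part of the weak gradient. -/
def strain (U : Set E3) (u : E3 → E3) (x : E3) : M3 :=
  (1 / 2 : ℝ) • ((weakGrad U u x).transpose + weakGrad U u x)

/-! ### The strain energy density -/

/-- The real-valued version of an extended-valued density, used where the density is finite. -/
def realDensity (W : M3 → ℝ≥0∞) (F : M3) : ℝ := (W F).toReal

/-- The value `D²W(F)[A, B]` of the second differential of `W` at `F`. -/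
def hess (W : M3 → ℝ≥0∞) (F A B : M3) : ℝ :=
  fderiv ℝ (fun G => fderiv ℝ (realDensity W) G A) F B

/-- The quadratic form `Q(F) = ½ Fᵀ D²W(I) F`. -/
def quadForm (W : M3 → ℝ≥0∞) (F : M3) : ℝ := (1 / 2 : ℝ) * hess W 1 F F

/-- The growth function `g_p`. -/
def growth (p t : ℝ) : ℝ := if t ≤ 1 then t ^ 2 else 2 * t ^ p / p - 2 / p + 1

/-- The assumptions on a homogeneous strain energy density with growth exponent `p`. -/
structure IsAdmissibleDensity (W : M3 → ℝ≥0∞) (p : ℝ) : Prop where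
  measurable : Measurable[borel M3] W
  /-- frame indifference -/
  frame : ∀ R ∈ SO3, ∀ F : M3, W (R * F) = W F
  /-- the minimal value `0` is attained at the identity -/
  natural : W 1 = 0
  /-- `C²` regularity near `SO(3)`, with a modulus of continuity for the second differential -/
  regular : ∃ (U : Set M3) (w : ℝ → ℝ) (K : ℝ), IsOpen U ∧ SO3 ⊆ U ∧
    MonotoneOn w (Ici 0) ∧ Tendsto w (𝓝[>] 0) (𝓝 0) ∧ 0 < K ∧
    (∀ F ∈ U, W F ≠ ⊤) ∧ ContDiffOn ℝ 2 (realDensity W) U ∧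
    (∀ A B : M3, |hess W 1 A B| ≤ K * ‖A‖ * ‖B‖) ∧
    ∀ F ∈ U, ∀ G ∈ U, ∀ A B : M3, |hess W F A B - hess W G A B| ≤ w ‖F - G‖ * ‖A‖ * ‖B‖
  /-- the growth exponent -/
  exponent : 1 < p ∧ p ≤ 2
  /-- growth from below -/
  coercive : ∃ C : ℝ, 0 < C ∧
    ∀ F : M3, ENNReal.ofReal (C * growth p (Metric.infDist F SO3)) ≤ W F

/-! ### The cylinder and the loads -/

/-- The cylinder `{x² + y² < 1, 0 < z < 1}`. -/
def cyl : Set E3 := {x | x 0 ^ 2 + x 1 ^ 2 < 1 ∧ 0 < x 2 ∧ x 2 < 1}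

/-- The radial profile `r ↦ φ(r, 0)` of a radial function of two variables. -/
def profile (φ : E2 → ℝ) (r : ℝ) : ℝ := φ !₂[r, 0]

/-- The assumptions on the horizontal potential `φ`. -/
structure IsHorizontalPotential (φ : E2 → ℝ) : Prop where
  smooth : ContDiffOn ℝ 2 φ (Metric.closedBall 0 1)
  radial : ∀ a ∈ Metric.closedBall (0 : E2) 1, ∀ b ∈ Metric.closedBall (0 : E2) 1,
    ‖a‖ = ‖b‖ → φ a = φ b
  laplacian_ne : ∃ a ∈ Metric.ball (0 : E2) 1, Laplacian.laplacian φ a ≠ 0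
  profile_one : profile φ 1 = 0
  deriv_profile_one : derivWithin (profile φ) (Icc 0 1) 1 = 0
  moment : ∫ r in (0 : ℝ)..1, r ^ 2 * derivWithin (profile φ) (Icc 0 1) r = 0

/-- The assumptions on the vertical load `ψ`, with strictly positive first moment. -/
structure IsVerticalLoad (ψ : ℝ → ℝ) : Prop where
  continuousOn : ContinuousOn ψ (Icc 0 1)
  integral_zero : ∫ z in (0 : ℝ)..1, ψ z = 0
  moment_pos : 0 < ∫ z in (0 : ℝ)..1, z * ψ z

/-- The body force `f(x, y, z) = (φ_x(x, y), φ_y(x, y), ψ(z))`. -/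
def force (φ : E2 → ℝ) (ψ : ℝ → ℝ) (x : E3) : E3 :=
  !₂[gradient φ !₂[x 0, x 1] 0, gradient φ !₂[x 0, x 1] 1, ψ (x 2)]

/-- The load functional `L(v) = ∫_Ω f · v`. -/
def load (φ : E2 → ℝ) (ψ : ℝ → ℝ) (v : E3 → E3) : ℝ :=
  ∫ x in cyl, ⟪force φ ψ x, v x⟫_ℝ

/-- The rotation kernel `{R ∈ SO(3) : L((R - I)x) = 0}`. -/
def rotKernel (φ : E2 → ℝ) (ψ : ℝ → ℝ) : Set M3 :=
  {R | R ∈ SO3 ∧ load φ ψ (matField (R - 1) fun x => x) = 0}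

/-- The rotation `R_θ` about the `z`-axis. -/
def rotZ (θ : ℝ) : M3 :=
  !![Real.cos θ, Real.sin θ, 0; -Real.sin θ, Real.cos θ, 0; 0, 0, 1]

/-! ### The energy functionals -/

open scoped Classical in
/-- Linearized elasticity: `∫ Q(E(u)) - L(u)` on `H¹`, and `+∞` elsewhere. -/
def linEnergy (W : M3 → ℝ≥0∞) (φ : E2 → ℝ) (ψ : ℝ → ℝ) (u : E3 → E3) : EReal :=
  if u ∈ W1 cyl 2 then
    (((∫ x in cyl, quadForm W (strain cyl u x)) - load φ ψ u : ℝ) : EReal)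
  else ⊤

open scoped Classical in
/-- The limit energy: `∫ Q(E(u)) - L(u) - max_R L((R - I)u)` on `H¹`, where `R` runs over the
rotation kernel, and `+∞` elsewhere. The maximum, of a continuous function of `R` over a nonempty
compact set, is written as a supremum. -/
def limEnergy (W : M3 → ℝ≥0∞) (φ : E2 → ℝ) (ψ : ℝ → ℝ) (u : E3 → E3) : EReal :=
  if u ∈ W1 cyl 2 then
    (((∫ x in cyl, quadForm W (strain cyl u x)) - load φ ψ u
      - sSup ((fun R => load φ ψ (matField (R - 1) u)) '' rotKernel φ ψ) : ℝ) : EReal)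
  else ⊤

open scoped Classical in
/-- The linear energy with rotated loads: `4 ∫ |E(u)|² - L(R_θ u)` on `H¹`, and `+∞` elsewhere. -/
def rotEnergy (φ : E2 → ℝ) (ψ : ℝ → ℝ) (θ : ℝ) (u : E3 → E3) : EReal :=
  if u ∈ W1 cyl 2 then
    ((4 * (∫ x in cyl, ‖strain cyl u x‖ ^ 2) - load φ ψ (matField (rotZ θ) u) : ℝ) : EReal)
  else ⊤

/-- `u` is a minimizer of `J` over the set `A`. -/
def IsArgmin (A : Set (E3 → E3)) (J : (E3 → E3) → EReal) (u : E3 → E3) : Prop :=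
  u ∈ A ∧ ∀ v ∈ A, J u ≤ J v

end ElasticGap

end

open ElasticGap

/-! For each angle `θ` the functional `rotEnergy` is a quadratic energy with a linear load, and its
minimizer can be written down explicitly. If a symmetric stress `σ` has divergence `-f_θ`, where
`f_θ = R_θᵀ f`, and zero normal component on the boundary, then `∫ f_θ · v = ∫ σ : E(v)` for all `v`
in `H¹`. Completing the square gives `4|E|² - σ : E ≥ -|σ|² / 16`, with equality when `E = σ / 8`.
So it suffices to find a displacement whose strain is `σ / 8`. This replaces compactness and Korn's
inequality.

Put `a(x) = ∫₀¹ t φ(t x) dt` in the plane. Then `div (a x) = φ`, and `a` vanishes on the unit circle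
because of the moment condition. The radial field `a (x, y)` is the gradient of a function whose
Laplacian is `φ`, so the divergence of its strain is `∇φ`. The rotated field `a (y, -x)` is
divergence free, and the divergence of its strain is only half of the rotated gradient `(φ_y,
-φ_x)`. A combination with weights `-c / 8` and `s / 4`, `c = cos θ` and `s = sin θ`, therefore
balances the horizontal load. The vertical load is balanced by a double primitive of `ψ`.

The minimum is minus half the work of the load. Since `∫ a x · ∇φ = -∫ φ²`, it equals `-½ ((c² / 8 +
s² / 4) ∫ φ² + Y)` with `Y` independent of `θ`. The twisting loads are twice as compliant as the
radial ones. This gives the interpolation formula in `cos² θ` and `sin² θ`, the minimum over `θ` at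
`-π / 2`, and, because `φ` is not identically zero, the strict gap.

All first moments of the force vanish except `∫ z ψ > 0`. The rotation kernel is thus exactly the
set of the `R_θ`, so `limEnergy` is the infimum of `rotEnergy` over `θ`, while `linEnergy` is the
case `θ = 0`.

The argument is carried by `integral_weak_div`, `div_stress`, `exists_bound_normal_stress`,
`strain_displacement`, `neg_integral_norm_stress_le`, `rotEnergyReal_displacement_eq` and
`mem_rotKernel_iff`. -/

noncomputable section

namespace ElasticGap

/-! ### Weak derivatives -/

/-- The partial derivative of a scalar function. -/
def partialDeriv (j : Fin 3) (v : E3 → ℝ) (x : E3) : ℝ :=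
  fderiv ℝ v x (EuclideanSpace.single j 1)

lemma integrableOn_mul_of_support {U K : Set E3} (hU : MeasurableSet U) (hK : IsCompact K)
    (hKU : K ⊆ U) {v f : E3 → ℝ} (hv : LocallyIntegrableOn v U) (hf : Continuous f)
    (hfK : ∀ x, x ∉ K → f x = 0) : IntegrableOn (fun x => v x * f x) U := by
  have h1 : IntegrableOn v K := hv.integrableOn_compact_subset hKU hK
  have h2 : IntegrableOn (fun x => v x * f x) K := h1.mul_continuousOn hf.continuousOn hK
  refine h2.of_forall_sdiff_eq_zero hU ?_
  intro x hx
  simp [hfK x hx.2]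

/-- Smooth test functions may be replaced by continuously differentiable ones. -/
lemma IsWeakPartial.integral_eq {U : Set E3} (hU : IsOpen U) {j : Fin 3} {v g : E3 → ℝ}
    (h : IsWeakPartial U j v g) {χ : E3 → ℝ} (hχ : ContDiff ℝ 1 χ) (hc : HasCompactSupport χ)
    (hs : tsupport χ ⊆ U) :
    ∫ x in U, v x * partialDeriv j χ x = -∫ x in U, g x * χ x := by
  -- Mollifying at scales at most `δ` keeps all supports in one compact set `K ⊆ U`.
  obtain ⟨δ, hδ, hδU⟩ := IsCompact.exists_cthickening_subset_open hc hU hs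
  set K := Metric.cthickening δ (tsupport χ) with hK
  have hKc : IsCompact K := IsCompact.cthickening hc
  let ρ : ℕ → ContDiffBump (0 : E3) := fun n =>
    { rIn := δ / (n + 1) / 2
      rOut := δ / (n + 1)
      rIn_pos := by positivity
      rIn_lt_rOut := half_lt_self (by positivity) }
  have hρ0 : Tendsto (fun n => (ρ n).rOut) atTop (𝓝 0) :=
    tendsto_const_div_atTop_nhds_zero_nat δ |>.comp (tendsto_add_atTop_nat 1) |>.congr
      (fun n => by simp [ρ])
  have hρδ : ∀ n, (ρ n).rOut ≤ δ := fun n => by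
    simp only [ρ]
    exact div_le_self hδ.le (by linarith [(Nat.cast_nonneg n : (0 : ℝ) ≤ n)])
  let L := ContinuousLinearMap.lsmul ℝ ℝ (E := ℝ)
  let c : (E3 → ℝ) → ℕ → E3 → ℝ := fun f n =>
    convolution ((ρ n).normed volume) f L volume
  have hρli : ∀ n, LocallyIntegrable ((ρ n).normed volume) (volume : Measure E3) := fun n =>
    ((ρ n).continuous_normed).locallyIntegrable
  have hsmooth : ∀ n, ContDiff ℝ ∞ (c χ n) := fun n =>
    HasCompactSupport.contDiff_convolution_left L ((ρ n).hasCompactSupport_normed)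
      ((ρ n).contDiff_normed) hχ.continuous.locallyIntegrable
  have hsupp : ∀ f : E3 → ℝ, Function.support f ⊆ tsupport χ → ∀ n x, x ∉ K → c f n x = 0 := by
    intro f hf n x hx
    by_contra hne
    have := support_convolution_subset L (Function.mem_support.2 hne)
    rw [(ρ n).support_normed_eq] at this
    obtain ⟨a, ha, b, hb, rfl⟩ := this
    apply hx
    apply Metric.mem_cthickening_of_dist_le _ b δ _ (hf hb)
    rw [mem_ball_zero_iff] at ha
    simpa using ha.le.trans (hρδ n)
  have hder : ∀ n x, partialDeriv j (c χ n) x = c (partialDeriv j χ) n x := by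
    intro n x
    have h1 := HasCompactSupport.hasFDerivAt_convolution_right L hc (hρli n) hχ x
    unfold partialDeriv
    rw [h1.fderiv]
    exact convolution_precompR_apply L (hρli n) (hc.fderiv ℝ) (hχ.continuous_fderiv one_ne_zero) x _
  have hpc : Continuous (partialDeriv j χ) :=
    (hχ.continuous_fderiv one_ne_zero).clm_apply continuous_const
  have hpcs : Function.support (partialDeriv j χ) ⊆ tsupport χ := by
    refine Subset.trans ?_ (support_fderiv_subset ℝ)
    intro x hx
    contrapose! hx
    simp only [Function.mem_support, not_not] at hx
    simp [partialDeriv, hx]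
  -- Mollifications of `f` converge pointwise, stay below the bound `C` of `|f|` and vanish off `K`,
  -- so `C |w|` on `K` dominates. This is used for both sides of the weak identity.
  have key : ∀ w f : E3 → ℝ, LocallyIntegrableOn w U → Continuous f →
      Function.support f ⊆ tsupport χ →
      Tendsto (fun n => ∫ x in U, w x * c f n x) atTop (𝓝 (∫ x in U, w x * f x)) := by
    intro w f hw hf hfs
    have hfcs : HasCompactSupport f := HasCompactSupport.of_support_subset_isCompact hc hfs
    obtain ⟨C, hC⟩ := hfcs.exists_bound_of_continuous hf
    have hcc : ∀ n, Continuous (c f n) := fun n =>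
      HasCompactSupport.continuous_convolution_right L hfcs (hρli n) hf
    have hC0 : 0 ≤ C := (norm_nonneg _).trans (hC 0)
    have hcb : ∀ n x, |c f n x| ≤ C := by
      intro n x
      have := dist_convolution_le (μ := (volume : Measure E3)) (f := (ρ n).normed volume) (x₀ := x)
        (g := f) (R := (ρ n).rOut) (z₀ := 0) hC0
        ((ρ n).support_normed_eq).subset (ρ n).nonneg_normed (ρ n).integral_normed
        hf.aestronglyMeasurable (fun y _ => by simpa using hC y)
      simpa using this
    refine tendsto_integral_of_dominated_convergence (fun x => K.indicator (fun x => C * |w x|) x)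
      ?_ ?_ ?_ ?_
    · intro n
      exact (integrableOn_mul_of_support hU.measurableSet hKc hδU hw (hcc n)
        (hsupp f hfs n)).aestronglyMeasurable
    · have h1 : IntegrableOn w K := hw.integrableOn_compact_subset hδU hKc
      have h2 : IntegrableOn (fun x => C * |w x|) K := (h1.norm.const_mul C)
      exact (h2.integrable_indicator hKc.measurableSet).integrableOn
    · intro n
      refine ae_of_all _ fun x => ?_
      by_cases hx : x ∈ K
      · rw [indicator_of_mem hx, norm_mul, Real.norm_eq_abs, Real.norm_eq_abs, mul_comm]
        exact mul_le_mul_of_nonneg_right (hcb n x) (abs_nonneg _)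
      · rw [indicator_of_notMem hx, hsupp f hfs n x hx]
        simp
    · refine ae_of_all _ fun x => ?_
      exact tendsto_const_nhds.mul
        (ContDiffBump.convolution_tendsto_right_of_continuous hρ0 hf x)
  have h1 := key v (partialDeriv j χ) h.1 hpc hpcs
  have h2 := (key g χ h.2.1 hχ.continuous subset_closure).neg
  refine tendsto_nhds_unique h1 (h2.congr fun n => ?_)
  have hsub : tsupport (c χ n) ⊆ K :=
    closure_minimal (fun x hx => by
      by_contra hxK
      exact hx (hsupp χ subset_closure n x hxK)) Metric.isClosed_cthickening
  rw [← h.2.2 (c χ n) (hsmooth n) (HasCompactSupport.of_support_subset_isCompact hKc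
    (subset_closure.trans hsub)) (hsub.trans hδU)]
  simp only [← hder]
  rfl

/-- The difference of two candidates annihilates every test function. -/
lemma IsWeakPartial.ae_eq {U : Set E3} (hU : IsOpen U) {j : Fin 3} {v g g' : E3 → ℝ}
    (h : IsWeakPartial U j v g) (h' : IsWeakPartial U j v g') :
    g =ᵐ[volume.restrict U] g' := by
  have := hU.ae_eq_zero_of_integral_contDiff_smul_eq_zero (μ := volume) (f := g - g')
    (h.2.1.sub h'.2.1) (fun χ hχ hc hs => by
      have h0 : ∀ x, x ∉ tsupport χ → χ x = 0 := fun x hx => image_eq_zero_of_notMem_tsupport hx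
      have e1 := h.2.2 χ hχ hc hs
      have e2 := h'.2.2 χ hχ hc hs
      have i1 := integrableOn_mul_of_support hU.measurableSet hc hs h.2.1 hχ.continuous h0
      have i2 := integrableOn_mul_of_support hU.measurableSet hc hs h'.2.1 hχ.continuous h0
      rw [← setIntegral_eq_integral_of_forall_compl_eq_zero (s := U)]
      · simp only [Pi.sub_apply, smul_eq_mul, mul_comm (χ _), sub_mul]
        rw [integral_sub i1 i2]
        linarith
      · intro x hx
        rw [h0 x (fun hx' => hx (hs hx')), zero_smul])
  rw [Filter.EventuallyEq, ae_restrict_iff' hU.measurableSet]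
  filter_upwards [this] with x hx hxU
  exact sub_eq_zero.1 (hx hxU)

lemma continuousOn_partialDeriv {U : Set E3} (hU : IsOpen U) {v : E3 → ℝ} (hv : ContDiffOn ℝ 1 v U)
    (j : Fin 3) : ContinuousOn (partialDeriv j v) U :=
  (hv.continuousOn_fderiv_of_isOpen hU le_rfl).clm_apply continuousOn_const

/-- A function which is continuously differentiable on `U`, times a test function on `U`. -/
lemma contDiff_mul_of_tsupport {U : Set E3} (hU : IsOpen U) {v χ : E3 → ℝ}
    (hv : ContDiffOn ℝ 1 v U) (hχ : ContDiff ℝ 1 χ) (hs : tsupport χ ⊆ U) :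
    ContDiff ℝ 1 (fun x => v x * χ x) := by
  refine contDiff_iff_contDiffAt.2 fun x => ?_
  by_cases hx : x ∈ tsupport χ
  · exact (hv.contDiffAt (hU.mem_nhds (hs hx))).mul hχ.contDiffAt
  · have : (fun x => v x * χ x) =ᶠ[𝓝 x] fun _ => 0 := by
      filter_upwards [notMem_tsupport_iff_eventuallyEq.1 hx] with y hy
      simp [hy]
    exact contDiffAt_const.congr_of_eventuallyEq this

lemma partialDeriv_mul {v χ : E3 → ℝ} {x : E3} (hv : DifferentiableAt ℝ v x)
    (hχ : DifferentiableAt ℝ χ x) (j : Fin 3) :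
    partialDeriv j (fun x => v x * χ x) x =
      v x * partialDeriv j χ x + partialDeriv j v x * χ x := by
  simp only [partialDeriv]
  rw [fderiv_fun_mul hv hχ]
  simp only [add_apply, smul_apply, smul_eq_mul]
  ring

lemma partialDeriv_eq_zero_of_notMem_tsupport {χ : E3 → ℝ} {x : E3} (hx : x ∉ tsupport χ)
    (j : Fin 3) : partialDeriv j χ x = 0 := by
  have : fderiv ℝ χ x = 0 := by
    by_contra h
    exact hx (support_fderiv_subset ℝ h)
  simp [partialDeriv, this]

/-- Integration by parts against the constant `1`. -/
lemma integral_partialDeriv_eq_zero {f : E3 → ℝ} (hf : ContDiff ℝ 1 f) (hc : HasCompactSupport f)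
    (j : Fin 3) : ∫ x, partialDeriv j f x = 0 := by
  have h := integral_mul_fderiv_eq_neg_fderiv_mul_of_integrable (μ := (volume : Measure E3))
    (f := fun _ => (1 : ℝ)) (g := f) (v := EuclideanSpace.single j 1)
    (by simp)
    (by
      simp only [one_mul]
      exact ((hf.continuous_fderiv one_ne_zero).clm_apply continuous_const).integrable_of_hasCompactSupport
        ((hc.fderiv ℝ).comp_left (g := fun A : E3 →L[ℝ] ℝ => A (EuclideanSpace.single j 1)) rfl))
    (by
      simp only [one_mul]
      exact hf.continuous.integrable_of_hasCompactSupport hc)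
    (fun x _ => differentiableAt_const _)
    (fun x _ => hf.differentiable one_ne_zero x)
  simpa [partialDeriv] using h

/-- Classical partial derivatives are weak ones. -/
lemma isWeakPartial_of_contDiffOn {U : Set E3} (hU : IsOpen U) {v : E3 → ℝ}
    (hv : ContDiffOn ℝ 1 v U) (j : Fin 3) : IsWeakPartial U j v (partialDeriv j v) := by
  have hvc := hv.continuousOn.locallyIntegrableOn (μ := volume) hU.measurableSet
  have hpc := (continuousOn_partialDeriv hU hv j).locallyIntegrableOn (μ := volume)
    hU.measurableSet
  refine ⟨hvc, hpc, fun χ hχ hc hs => ?_⟩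
  have hχ1 : ContDiff ℝ 1 χ := hχ.of_le (by norm_cast)
  have h0 : ∀ x, x ∉ tsupport χ → χ x = 0 := fun x hx => image_eq_zero_of_notMem_tsupport hx
  -- The product `v χ` is globally `C¹` with compact support, so its derivative has integral zero;
  -- the product rule then gives the weak identity.
  have hm := contDiff_mul_of_tsupport hU hv hχ1 hs
  have h1 := integral_partialDeriv_eq_zero hm (hc.mul_left) j
  have i1 := integrableOn_mul_of_support hU.measurableSet hc hs hvc (f := partialDeriv j χ)
    ((hχ1.continuous_fderiv one_ne_zero).clm_apply continuous_const)
    (fun x hx => partialDeriv_eq_zero_of_notMem_tsupport hx j)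
  have i2 := integrableOn_mul_of_support hU.measurableSet hc hs hpc hχ1.continuous h0
  rw [← setIntegral_eq_integral_of_forall_compl_eq_zero (s := U)] at h1
  · have h2 : ∫ x in U, partialDeriv j (fun x => v x * χ x) x =
        ∫ x in U, (v x * partialDeriv j χ x + partialDeriv j v x * χ x) := by
      refine setIntegral_congr_fun hU.measurableSet fun x hx => ?_
      exact partialDeriv_mul ((hv.contDiffAt (hU.mem_nhds hx)).differentiableAt one_ne_zero)
        (hχ1.differentiable one_ne_zero x) j
    rw [h2, integral_add i1 i2] at h1
    exact eq_neg_of_add_eq_zero_left h1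
  · intro x hx
    refine partialDeriv_eq_zero_of_notMem_tsupport (fun hx' => hx (hs ?_)) j
    exact closure_mono (Function.support_mul_subset_right _ _) hx'

lemma isWeakPartial_weakPartial {U : Set E3} {j : Fin 3} {v g : E3 → ℝ}
    (h : IsWeakPartial U j v g) : IsWeakPartial U j v (weakPartial U j v) := by
  have hex : ∃ g, IsWeakPartial U j v g := ⟨g, h⟩
  rw [weakPartial, dif_pos hex]
  exact Classical.choose_spec hex

lemma weakPartial_ae_eq {U : Set E3} (hU : IsOpen U) {j : Fin 3} {v g : E3 → ℝ}
    (h : IsWeakPartial U j v g) : weakPartial U j v =ᵐ[volume.restrict U] g :=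
  (isWeakPartial_weakPartial h).ae_eq hU h

lemma memLp_weakPartial {U : Set E3} (hU : IsOpen U) {q : ℝ≥0∞} {u : E3 → E3} (hu : u ∈ W1 U q)
    (i j : Fin 3) : MemLp (weakPartial U j fun x => u x i) q (volume.restrict U) ∧
      IsWeakPartial U j (fun x => u x i) (weakPartial U j fun x => u x i) := by
  obtain ⟨g, hg, hw⟩ := (hu i).2 j
  exact ⟨hg.ae_eq (weakPartial_ae_eq hU hw).symm, isWeakPartial_weakPartial hw⟩

/-! ### Rules for partial derivatives -/

lemma partialDeriv_const (j : Fin 3) (c : ℝ) (x : E3) : partialDeriv j (fun _ => c) x = 0 := by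
  simp [partialDeriv]

lemma partialDeriv_coord (i j : Fin 3) (x : E3) :
    partialDeriv j (fun y => y i) x = if i = j then 1 else 0 := by
  have h : HasFDerivAt (fun y : E3 => y i) (EuclideanSpace.proj i : E3 →L[ℝ] ℝ) x :=
    (EuclideanSpace.proj i : E3 →L[ℝ] ℝ).hasFDerivAt
  simp [partialDeriv, h.fderiv]

lemma partialDeriv_add {v w : E3 → ℝ} {x : E3} (hv : DifferentiableAt ℝ v x)
    (hw : DifferentiableAt ℝ w x) (j : Fin 3) :
    partialDeriv j (fun x => v x + w x) x = partialDeriv j v x + partialDeriv j w x := by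
  simp [partialDeriv, fderiv_fun_add hv hw]

lemma partialDeriv_sub {v w : E3 → ℝ} {x : E3} (hv : DifferentiableAt ℝ v x)
    (hw : DifferentiableAt ℝ w x) (j : Fin 3) :
    partialDeriv j (fun x => v x - w x) x = partialDeriv j v x - partialDeriv j w x := by
  simp [partialDeriv, fderiv_fun_sub hv hw]

lemma partialDeriv_neg {v : E3 → ℝ} {x : E3} (j : Fin 3) :
    partialDeriv j (fun x => -v x) x = -partialDeriv j v x := by
  simp [partialDeriv, fderiv_fun_neg]

lemma partialDeriv_comp {f : ℝ → ℝ} {v : E3 → ℝ} {x : E3} (hf : DifferentiableAt ℝ f (v x))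
    (hv : DifferentiableAt ℝ v x) (j : Fin 3) :
    partialDeriv j (fun x => f (v x)) x = deriv f (v x) * partialDeriv j v x := by
  have := hf.hasDerivAt.comp_hasFDerivAt x hv.hasFDerivAt
  simp only [partialDeriv]
  rw [show (fun x => f (v x)) = f ∘ v from rfl, this.fderiv]
  simp

lemma partialDeriv_congr {U : Set E3} (hU : IsOpen U) {v w : E3 → ℝ} (h : EqOn v w U) {x : E3}
    (hx : x ∈ U) (j : Fin 3) : partialDeriv j v x = partialDeriv j w x := by
  have : v =ᶠ[𝓝 x] w := h.eventuallyEq_of_mem (hU.mem_nhds hx)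
  simp [partialDeriv, this.fderiv_eq]

@[fun_prop]
lemma contDiff_coord (n : WithTop ℕ∞) (i : Fin 3) : ContDiff ℝ n (fun x : E3 => x i) :=
  (EuclideanSpace.proj i : E3 →L[ℝ] ℝ).contDiff

/-! ### The cylinder -/

lemma isOpen_cyl : IsOpen cyl := by
  have h : Continuous fun x : E3 => x 0 ^ 2 + x 1 ^ 2 := by fun_prop
  exact (isOpen_lt h continuous_const).inter
    ((isOpen_lt continuous_const (by fun_prop : Continuous fun x : E3 => x 2)).inter
      (isOpen_lt (by fun_prop : Continuous fun x : E3 => x 2) continuous_const))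

lemma measurableSet_cyl : MeasurableSet cyl := isOpen_cyl.measurableSet

lemma abs_coord_lt {x : E3} (hx : x ∈ cyl) (i : Fin 3) : |x i| ≤ 1 := by
  obtain ⟨h1, h2, h3⟩ := hx
  rw [abs_le]
  fin_cases i
  · constructor <;> simp only [Fin.zero_eta] <;> nlinarith [sq_nonneg (x 1)]
  · constructor <;> simp only [Fin.mk_one] <;> nlinarith [sq_nonneg (x 0)]
  · constructor <;> simp only [Fin.reduceFinMk] <;> linarith

lemma isBounded_cyl : Bornology.IsBounded cyl := by
  refine (Metric.isBounded_closedBall (x := (0 : E3)) (r := 2)).subset fun x hx => ?_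
  obtain ⟨h1, h2, h3⟩ := hx
  rw [mem_closedBall_zero_iff, EuclideanSpace.norm_eq, Real.sqrt_le_left (by norm_num)]
  simp only [Real.norm_eq_abs, sq_abs, Fin.sum_univ_three]
  nlinarith

lemma volume_cyl_lt_top : volume cyl < ⊤ := isBounded_cyl.measure_lt_top

instance : IsFiniteMeasure (volume.restrict cyl) := ⟨by simpa using volume_cyl_lt_top⟩

/-! ### Cutoff functions -/

/-- With `y = n t - 1` the quantity bounded is `t (ramp n)'(t)`, so the bound is uniform in `n`: the
slope of a cutoff at distance `t` from the boundary is at most `B / t`. -/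
lemma exists_bound_deriv_smoothTransition :
    ∃ B : ℝ, 0 ≤ B ∧ ∀ y : ℝ, |(y + 1) * deriv Real.smoothTransition y| ≤ B := by
  have hc : Continuous fun y : ℝ => (y + 1) * deriv Real.smoothTransition y :=
    (continuous_id.add continuous_const).mul
      ((Real.smoothTransition.contDiff (n := 1)).continuous_deriv le_rfl)
  obtain ⟨B, hB⟩ := isCompact_Icc (a := (0 : ℝ)) (b := 1) |>.exists_bound_of_continuousOn
    hc.continuousOn
  refine ⟨B, (norm_nonneg _).trans (hB 0 (by simp)), fun y => ?_⟩
  by_cases hy : y ∈ Icc (0 : ℝ) 1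
  · exact hB y hy
  · have : deriv Real.smoothTransition y = 0 := by
      rw [mem_Icc, not_and_or, not_le, not_le] at hy
      rcases hy with hy | hy
      · have : Real.smoothTransition =ᶠ[𝓝 y] fun _ => 0 := by
          filter_upwards [Iio_mem_nhds hy] with z hz
          exact Real.smoothTransition.zero_of_nonpos (le_of_lt hz)
        simp [this.deriv_eq]
      · have : Real.smoothTransition =ᶠ[𝓝 y] fun _ => 1 := by
          filter_upwards [Ioi_mem_nhds hy] with z hz
          exact Real.smoothTransition.one_of_one_le (le_of_lt hz)
        simp [this.deriv_eq]
    simpa [this] using (norm_nonneg _).trans (hB 0 (by simp))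

/-- A smooth function on the line which vanishes for `t ≤ 1 / n` and is `1` for `t ≥ 2 / n`. -/
def ramp (n : ℕ) (t : ℝ) : ℝ := Real.smoothTransition (n * t - 1)

lemma contDiff_ramp (n : ℕ) (k : ℕ∞) : ContDiff ℝ k (ramp n) :=
  Real.smoothTransition.contDiff.comp (by fun_prop)

lemma deriv_ramp (n : ℕ) (t : ℝ) :
    deriv (ramp n) t = n * deriv Real.smoothTransition (n * t - 1) := by
  have h1 : HasDerivAt (fun t : ℝ => (n : ℝ) * t - 1) n t := by
    simpa using ((hasDerivAt_id t).const_mul (n : ℝ)).sub_const 1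
  have h2 := ((Real.smoothTransition.contDiff (n := 1)).differentiable one_ne_zero
    (n * t - 1)).hasDerivAt
  have := h2.comp t h1
  rw [show ramp n = Real.smoothTransition ∘ fun t : ℝ => (n : ℝ) * t - 1 from rfl, this.deriv]
  ring

lemma ramp_mem (n : ℕ) (t : ℝ) : 0 ≤ ramp n t ∧ ramp n t ≤ 1 :=
  ⟨Real.smoothTransition.nonneg _, Real.smoothTransition.le_one _⟩

lemma ramp_eventually {t : ℝ} (ht : 0 < t) :
    ∀ᶠ n in atTop, ramp n t = 1 ∧ deriv (ramp n) t = 0 := by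
  -- This makes `n t - 1 > 1`, strictly inside the region where the transition is constant, so that
  -- the derivative vanishes as well.
  obtain ⟨N, hN⟩ := exists_nat_gt (3 / t)
  filter_upwards [eventually_ge_atTop N] with n hn
  have h3 : 3 < n * t := by
    have : (N : ℝ) ≤ n := by exact_mod_cast hn
    exact (div_lt_iff₀ ht).1 (hN.trans_le this)
  refine ⟨Real.smoothTransition.one_of_one_le (by linarith), ?_⟩
  have : Real.smoothTransition =ᶠ[𝓝 (n * t - 1)] fun _ => 1 := by
    filter_upwards [Ioi_mem_nhds (show (1 : ℝ) < n * t - 1 by linarith)] with z hz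
    exact Real.smoothTransition.one_of_one_le (le_of_lt hz)
  simp [deriv_ramp, this.deriv_eq]

/-- Smooth cutoff functions, compactly supported in the cylinder, which exhaust it. -/
def cutoff (n : ℕ) (x : E3) : ℝ := ramp n (1 - x 0 ^ 2 - x 1 ^ 2) * ramp n (x 2 * (1 - x 2))

lemma contDiff_cutoff (n : ℕ) : ContDiff ℝ 1 (cutoff n) :=
  ((contDiff_ramp n 1).comp (by fun_prop)).mul ((contDiff_ramp n 1).comp (by fun_prop))

lemma tsupport_cutoff (n : ℕ) : tsupport (cutoff n) ⊆ cyl := by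
  -- For `n = 0` the ramp is the transition at `-1`, and the cutoff is identically zero.
  rcases Nat.eq_zero_or_pos n with rfl | hn
  · have : cutoff 0 = 0 := by
      funext x
      simp [cutoff, ramp, Real.smoothTransition.zero_of_nonpos]
    simp [this, tsupport]
  have hn' : (0 : ℝ) < n := by exact_mod_cast hn
  have hcl : IsClosed {x : E3 | 1 ≤ n * (1 - x 0 ^ 2 - x 1 ^ 2) ∧ 1 ≤ n * (x 2 * (1 - x 2))} :=
    by
    rw [ofPred_and]
    refine IsClosed.inter (isClosed_le continuous_const ?_) (isClosed_le continuous_const ?_) <;>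
      fun_prop
  refine (closure_minimal (fun x hx => ?_) hcl).trans fun x hx => ?_
  · rw [Function.mem_support, cutoff, mul_ne_zero_iff] at hx
    constructor
    · by_contra h
      exact hx.1 (Real.smoothTransition.zero_of_nonpos (by linarith))
    · by_contra h
      exact hx.2 (Real.smoothTransition.zero_of_nonpos (by linarith))
  · obtain ⟨h1, h2⟩ := hx
    have h1' : 0 < 1 - x 0 ^ 2 - x 1 ^ 2 := pos_of_mul_pos_right (by linarith) hn'.le
    have h2' : 0 < x 2 * (1 - x 2) := pos_of_mul_pos_right (by linarith) hn'.le
    refine ⟨by linarith, ?_, ?_⟩ <;> nlinarith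

lemma hasCompactSupport_cutoff (n : ℕ) : HasCompactSupport (cutoff n) :=
  Metric.isCompact_of_isClosed_isBounded (isClosed_tsupport _)
    (isBounded_cyl.subset (tsupport_cutoff n))

/-- One factor has a horizontal radial gradient and the other a vertical one. Pairing with a field
thus involves only `x 0 * s 0 + x 1 * s 1` and `s 2`, the normal components on the lateral surface
and on the bases. -/
lemma partialDeriv_cutoff (n : ℕ) (x : E3) (j : Fin 3) :
    partialDeriv j (cutoff n) x =
      (if j = 2 then 0 else -2 * x j) * deriv (ramp n) (1 - x 0 ^ 2 - x 1 ^ 2) *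
        ramp n (x 2 * (1 - x 2)) +
      (if j = 2 then 1 - 2 * x 2 else 0) * deriv (ramp n) (x 2 * (1 - x 2)) *
        ramp n (1 - x 0 ^ 2 - x 1 ^ 2) := by
  have hr : ∀ t, DifferentiableAt ℝ (ramp n) t := fun t =>
    (contDiff_ramp n 1).differentiable one_ne_zero t
  have e0 : partialDeriv j (fun x => x 0 ^ 2) x = if j = 0 then 2 * x 0 else 0 := by
    simp only [pow_two]
    rw [partialDeriv_mul (by fun_prop) (by fun_prop), partialDeriv_coord]
    fin_cases j <;> simp
    ring
  have e1 : partialDeriv j (fun x => x 1 ^ 2) x = if j = 1 then 2 * x 1 else 0 := by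
    simp only [pow_two]
    rw [partialDeriv_mul (by fun_prop) (by fun_prop), partialDeriv_coord]
    fin_cases j <;> simp
    ring
  have e2 : partialDeriv j (fun x => x 2 * (1 - x 2)) x = if j = 2 then 1 - 2 * x 2 else 0 := by
    rw [partialDeriv_mul (by fun_prop) (by fun_prop),
      partialDeriv_sub (by fun_prop) (by fun_prop), partialDeriv_coord, partialDeriv_const]
    fin_cases j <;> simp
    ring
  have d1 : DifferentiableAt ℝ (fun x : E3 => 1 - x 0 ^ 2 - x 1 ^ 2) x := by fun_prop
  have d2 : DifferentiableAt ℝ (fun x : E3 => x 2 * (1 - x 2)) x := by fun_prop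
  have e3 : partialDeriv j (fun x => 1 - x 0 ^ 2 - x 1 ^ 2) x =
      if j = 2 then 0 else -2 * x j := by
    rw [partialDeriv_sub (by fun_prop) (by fun_prop),
      partialDeriv_sub (by fun_prop) (by fun_prop), partialDeriv_const, e0, e1]
    fin_cases j <;> simp
  change partialDeriv j (fun x => ramp n (1 - x 0 ^ 2 - x 1 ^ 2) * ramp n (x 2 * (1 - x 2))) x = _
  rw [partialDeriv_mul (v := fun x => ramp n (1 - x 0 ^ 2 - x 1 ^ 2))
    (χ := fun x => ramp n (x 2 * (1 - x 2))) ((hr _).comp x d1) ((hr _).comp x d2),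
    partialDeriv_comp (hr _) d1,
    partialDeriv_comp (hr _) d2, e2, e3]
  ring

/-! ### Integration by parts on the cylinder -/

lemma integrableOn_of_bound {f : E3 → ℝ} (hf : ContinuousOn f cyl) {C : ℝ}
    (hC : ∀ x ∈ cyl, |f x| ≤ C) : IntegrableOn f cyl :=
  Integrable.of_bound (hf.aestronglyMeasurable measurableSet_cyl) C
    ((ae_restrict_iff' measurableSet_cyl).2 (ae_of_all _ hC))

lemma integrableOn_mul_of_bound {w f : E3 → ℝ} (hw : IntegrableOn w cyl)
    (hf : ContinuousOn f cyl) {C : ℝ} (hC : ∀ x ∈ cyl, |f x| ≤ C) :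
    IntegrableOn (fun x => f x * w x) cyl :=
  Integrable.bdd_mul (c := C) hw (hf.aestronglyMeasurable measurableSet_cyl)
    ((ae_restrict_iff' measurableSet_cyl).2 (ae_of_all _ hC))

/-- The divergence theorem for a continuously differentiable field with vanishing normal component
on the boundary of the cylinder, against a weakly differentiable function. -/
theorem integral_weak_div {s : Fin 3 → E3 → ℝ} (hs : ∀ j, ContDiffOn ℝ 1 (s j) cyl) {C : ℝ}
    (hb : ∀ x ∈ cyl, ∀ j, |s j x| ≤ C)
    (hlat : ∀ x ∈ cyl, |x 0 * s 0 x + x 1 * s 1 x| ≤ C * (1 - x 0 ^ 2 - x 1 ^ 2))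
    (hver : ∀ x ∈ cyl, |s 2 x| ≤ C * (x 2 * (1 - x 2)))
    (hd : ∀ x ∈ cyl, |∑ j, partialDeriv j (s j) x| ≤ C)
    {w : E3 → ℝ} {g : Fin 3 → E3 → ℝ} (hw : IntegrableOn w cyl) (hg : ∀ j, IntegrableOn (g j) cyl)
    (h : ∀ j, IsWeakPartial cyl j w (g j)) :
    ∫ x in cyl, ∑ j, s j x * g j x = -∫ x in cyl, (∑ j, partialDeriv j (s j) x) * w x := by
  obtain ⟨B, hB0, hB⟩ := exists_bound_deriv_smoothTransition
  -- The sign of `C` follows from the bound at any point of the cylinder; on an empty domain there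
  -- is nothing to prove.
  have hC0 : 0 ≤ C ∨ cyl = ∅ := by
    rcases cyl.eq_empty_or_nonempty with h | ⟨x, hx⟩
    · exact Or.inr h
    · exact Or.inl ((abs_nonneg _).trans (hb x hx 0))
  rcases hC0 with hC0 | hC0
  swap
  · simp [hC0]
  have hsd : ∀ j, ∀ x ∈ cyl, DifferentiableAt ℝ (s j) x := fun j x hx =>
    ((hs j).contDiffAt (isOpen_cyl.mem_nhds hx)).differentiableAt one_ne_zero
  have hηd : ∀ n x, DifferentiableAt ℝ (cutoff n) x := fun n x =>
    (contDiff_cutoff n).differentiable one_ne_zero x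
  have hηm : ∀ n x, |cutoff n x| ≤ 1 := by
    intro n x
    obtain ⟨h1, h2⟩ := ramp_mem n (1 - x 0 ^ 2 - x 1 ^ 2)
    obtain ⟨h3, h4⟩ := ramp_mem n (x 2 * (1 - x 2))
    rw [cutoff, abs_of_nonneg (mul_nonneg h1 h3)]
    exact mul_le_one₀ h2 h3 h4
  have hdivc : ContinuousOn (fun x => ∑ j, partialDeriv j (s j) x) cyl :=
    continuousOn_finsetSum _ fun j _ => continuousOn_partialDeriv isOpen_cyl (hs j) j
  have hηc : ∀ n, Continuous (cutoff n) := fun n => (contDiff_cutoff n).continuous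
  have hηpc : ∀ n j, Continuous (partialDeriv j (cutoff n)) := fun n j =>
    ((contDiff_cutoff n).continuous_fderiv one_ne_zero).clm_apply continuous_const
  -- the commutator of the field with the cutoff is bounded
  have hcomm : ∀ n, ∀ x ∈ cyl, |∑ j, s j x * partialDeriv j (cutoff n) x| ≤ 3 * C * B := by
    intro n x hx
    have hx' := hx
    obtain ⟨h1, h2, h3⟩ := hx'
    obtain ⟨r1, r2⟩ := ramp_mem n (1 - x 0 ^ 2 - x 1 ^ 2)
    obtain ⟨r3, r4⟩ := ramp_mem n (x 2 * (1 - x 2))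
    have hp : 0 < 1 - x 0 ^ 2 - x 1 ^ 2 := by linarith
    have hq : 0 < x 2 * (1 - x 2) := mul_pos h2 (by linarith)
    -- The linear decay of the normal component cancels the `1 / t` growth of the slope of the ramp.
    have hr : ∀ t, 0 < t → ∀ y, |y| ≤ C * t → |y * deriv (ramp n) t| ≤ C * B := by
      intro t ht y hy
      have := hB (n * t - 1)
      rw [sub_add_cancel, show (n : ℝ) * t * deriv Real.smoothTransition (n * t - 1) =
        t * deriv (ramp n) t by rw [deriv_ramp]; ring, abs_mul, abs_of_pos ht] at this
      rw [abs_mul]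
      calc |y| * |deriv (ramp n) t| ≤ C * t * |deriv (ramp n) t| :=
            mul_le_mul_of_nonneg_right hy (abs_nonneg _)
        _ = C * (t * |deriv (ramp n) t|) := by ring
        _ ≤ C * B := mul_le_mul_of_nonneg_left this hC0
    have k1 := hr _ hp _ (hlat x hx)
    have k2 := hr _ hq _ (hver x hx)
    have e : ∑ j, s j x * partialDeriv j (cutoff n) x =
        -2 * (((x 0 * s 0 x + x 1 * s 1 x) * deriv (ramp n) (1 - x 0 ^ 2 - x 1 ^ 2)) *
          ramp n (x 2 * (1 - x 2))) +
        (1 - 2 * x 2) * ((s 2 x * deriv (ramp n) (x 2 * (1 - x 2))) *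
          ramp n (1 - x 0 ^ 2 - x 1 ^ 2)) := by
      simp only [Fin.sum_univ_three, partialDeriv_cutoff]
      simp
      ring
    have m1 : ∀ y r : ℝ, |y| ≤ C * B → 0 ≤ r → r ≤ 1 → |y * r| ≤ C * B := by
      intro y r hy hr0 hr1
      rw [abs_mul, abs_of_nonneg hr0]
      exact (mul_le_of_le_one_right (abs_nonneg _) hr1).trans hy
    have n1 := m1 _ _ k1 r3 r4
    have n2 := m1 _ _ k2 r1 r2
    rw [e]
    refine (abs_add_le _ _).trans ?_
    rw [abs_mul, abs_mul (1 - 2 * x 2)]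
    have : |1 - 2 * x 2| ≤ 1 := abs_le.2 ⟨by linarith, by linarith⟩
    have n3 := (mul_le_of_le_one_left (abs_nonneg _) this).trans n2
    rw [show |(-2 : ℝ)| = 2 by norm_num]
    linarith
  -- The weak derivatives are tested with the compactly supported fields `s j * cutoff n`, and the
  -- identities are summed over `j`.
  have hident : ∀ n, ∫ x in cyl, (cutoff n x * ∑ j, partialDeriv j (s j) x +
      ∑ j, s j x * partialDeriv j (cutoff n) x) * w x =
      -∫ x in cyl, (cutoff n x * ∑ j, s j x * g j x) := by
    intro n
    have ht : ∀ j, ContDiff ℝ 1 (fun x => s j x * cutoff n x) := fun j =>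
      contDiff_mul_of_tsupport isOpen_cyl (hs j) (contDiff_cutoff n) (tsupport_cutoff n)
    have hcs : ∀ j, HasCompactSupport (fun x => s j x * cutoff n x) := fun j =>
      (hasCompactSupport_cutoff n).mul_left
    have hts : ∀ j, tsupport (fun x => s j x * cutoff n x) ⊆ cyl := fun j =>
      (closure_mono (Function.support_mul_subset_right _ _)).trans (tsupport_cutoff n)
    have key := fun j => (h j).integral_eq isOpen_cyl (ht j) (hcs j) (hts j)
    have i1 : ∀ j, IntegrableOn
        (fun x => w x * partialDeriv j (fun x => s j x * cutoff n x) x) cyl := fun j =>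
      integrableOn_mul_of_support measurableSet_cyl (hcs j) (hts j) (h j).1
        (((ht j).continuous_fderiv one_ne_zero).clm_apply continuous_const)
        (fun x hx => partialDeriv_eq_zero_of_notMem_tsupport hx j)
    have i2 : ∀ j, IntegrableOn (fun x => g j x * (s j x * cutoff n x)) cyl := fun j =>
      integrableOn_mul_of_support measurableSet_cyl (hcs j) (hts j) (h j).2.1
        (ht j).continuous (fun x hx =>
          image_eq_zero_of_notMem_tsupport (f := fun x => s j x * cutoff n x) hx)
    have e1 : ∫ x in cyl, (cutoff n x * ∑ j, partialDeriv j (s j) x +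
        ∑ j, s j x * partialDeriv j (cutoff n) x) * w x =
        ∑ j, ∫ x in cyl, w x * partialDeriv j (fun x => s j x * cutoff n x) x := by
      rw [← integral_finsetSum _ fun j _ => i1 j]
      refine setIntegral_congr_fun measurableSet_cyl fun x hx => ?_
      simp only [fun j => partialDeriv_mul (hsd j x hx) (hηd n x) j, Fin.sum_univ_three]
      ring
    have e2 : ∫ x in cyl, (cutoff n x * ∑ j, s j x * g j x) =
        ∑ j, ∫ x in cyl, g j x * (s j x * cutoff n x) := by
      rw [← integral_finsetSum _ fun j _ => i2 j]
      refine setIntegral_congr_fun measurableSet_cyl fun x hx => ?_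
      simp only [Fin.sum_univ_three]
      ring
    rw [e1, e2, Finset.sum_congr rfl fun j _ => key j, Finset.sum_neg_distrib]
  -- At a fixed point the cutoff is eventually `1` with zero gradient, so the bounded commutator
  -- disappears in the limit by dominated convergence.
  have hev : ∀ x ∈ cyl, ∀ᶠ n in atTop, cutoff n x = 1 ∧ ∀ j, partialDeriv j (cutoff n) x = 0 := by
    rintro x ⟨h1, h2, h3⟩
    filter_upwards [ramp_eventually (show 0 < 1 - x 0 ^ 2 - x 1 ^ 2 by linarith),
      ramp_eventually (mul_pos h2 (show 0 < 1 - x 2 by linarith))] with n hn1 hn2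
    exact ⟨by simp [cutoff, hn1.1, hn2.1], fun j => by simp [partialDeriv_cutoff, hn1.2, hn2.2]⟩
  have lim1 : Tendsto (fun n => ∫ x in cyl, (cutoff n x * ∑ j, partialDeriv j (s j) x +
      ∑ j, s j x * partialDeriv j (cutoff n) x) * w x) atTop
      (𝓝 (∫ x in cyl, (∑ j, partialDeriv j (s j) x) * w x)) := by
    refine tendsto_integral_of_dominated_convergence (fun x => (C + 3 * C * B) * |w x|) ?_
      (hw.norm.const_mul _) ?_ ?_
    · intro n
      refine AEStronglyMeasurable.mul ?_ hw.aestronglyMeasurable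
      refine ContinuousOn.aestronglyMeasurable ?_ measurableSet_cyl
      refine ((hηc n).continuousOn.mul hdivc).add (continuousOn_finsetSum _ fun j _ => ?_)
      exact (hs j).continuousOn.mul (hηpc n j).continuousOn
    · intro n
      refine (ae_restrict_iff' measurableSet_cyl).2 (ae_of_all _ fun x hx => ?_)
      rw [norm_mul, Real.norm_eq_abs, Real.norm_eq_abs]
      refine mul_le_mul_of_nonneg_right ((abs_add_le _ _).trans (add_le_add ?_ (hcomm n x hx)))
        (abs_nonneg _)
      rw [abs_mul]
      exact (mul_le_of_le_one_left (abs_nonneg _) (hηm n x)).trans (hd x hx)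
    · refine (ae_restrict_iff' measurableSet_cyl).2 (ae_of_all _ fun x hx => ?_)
      refine tendsto_const_nhds.congr' ?_
      filter_upwards [hev x hx] with n hn
      simp [hn.1, hn.2]
  have hsg : IntegrableOn (fun x => ∑ j, s j x * g j x) cyl :=
    integrable_finsetSum _ fun j _ => integrableOn_mul_of_bound (hg j) (hs j).continuousOn
      fun x hx => hb x hx j
  have lim2 : Tendsto (fun n => ∫ x in cyl, (cutoff n x * ∑ j, s j x * g j x)) atTop
      (𝓝 (∫ x in cyl, ∑ j, s j x * g j x)) := by
    refine tendsto_integral_of_dominated_convergence (fun x => |∑ j, s j x * g j x|) ?_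
      hsg.norm ?_ ?_
    · intro n
      exact (hηc n).aestronglyMeasurable.mul hsg.aestronglyMeasurable
    · intro n
      refine ae_of_all _ fun x => ?_
      rw [norm_mul, Real.norm_eq_abs, Real.norm_eq_abs]
      exact mul_le_of_le_one_left (abs_nonneg _) (hηm n x)
    · refine (ae_restrict_iff' measurableSet_cyl).2 (ae_of_all _ fun x hx => ?_)
      refine tendsto_const_nhds.congr' ?_
      filter_upwards [hev x hx] with n hn
      simp [hn.1]
  have := tendsto_nhds_unique lim1 (lim2.neg.congr fun n => (hident n).symm)
  rw [this, neg_neg]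

/-! ### Averages along rays -/

lemma smul_mem_ball_of_mem_Icc {E : Type*} [NormedAddCommGroup E] [NormedSpace ℝ E] {x : E}
    {ρ t : ℝ} (hx : x ∈ Metric.ball (0 : E) ρ) (ht : t ∈ Icc (0 : ℝ) 1) :
    t • x ∈ Metric.ball (0 : E) ρ := by
  rw [mem_ball_zero_iff] at hx ⊢
  rw [norm_smul, Real.norm_eq_abs, abs_of_nonneg ht.1]
  exact (mul_le_of_le_one_left (norm_nonneg _) ht.2).trans_lt hx

/-- The weighted average of `G` along the segment from the origin to `x`. -/
def rayMean {F : Type*} [NormedAddCommGroup F] [NormedSpace ℝ F] (k : ℕ) (G : E2 → F) (x : E2) :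
    F := ∫ t in (0 : ℝ)..1, t ^ k • G (t • x)

section RayMean

variable {F : Type*} [NormedAddCommGroup F] [NormedSpace ℝ F] {G : E2 → F}

lemma continuousOn_ray (k : ℕ) (hG : ContinuousOn G (Metric.ball 0 1)) {x : E2}
    (hx : x ∈ Metric.ball (0 : E2) 1) : ContinuousOn (fun t : ℝ => t ^ k • G (t • x)) (Icc 0 1) := by
  refine (continuousOn_pow k).smul (hG.comp (by fun_prop) ?_)
  exact fun t ht => smul_mem_ball_of_mem_Icc hx ht

lemma aestronglyMeasurable_ray (k : ℕ) (hG : ContinuousOn G (Metric.ball 0 1)) {x : E2}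
    (hx : x ∈ Metric.ball (0 : E2) 1) :
    AEStronglyMeasurable (fun t : ℝ => t ^ k • G (t • x)) (volume.restrict (uIoc 0 1)) := by
  rw [uIoc_of_le zero_le_one]
  exact ((continuousOn_ray k hG hx).mono Ioc_subset_Icc_self).aestronglyMeasurable measurableSet_Ioc

/-- Continuity on the open disc gives no bound up to the circle, but a smaller ball contains all
segments from the origin to its points. The bound, uniform in `t`, allows passing to the limit and
differentiating under the integral. -/
lemma exists_local_bound_ray (hG : ContinuousOn G (Metric.ball 0 1)) {x : E2}
    (hx : x ∈ Metric.ball (0 : E2) 1) : ∃ C : ℝ, ∃ ρ : ℝ, ρ < 1 ∧ x ∈ Metric.ball (0 : E2) ρ ∧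
      ∀ y ∈ Metric.ball (0 : E2) ρ, ∀ k : ℕ, ∀ t ∈ Icc (0 : ℝ) 1, ‖t ^ k • G (t • y)‖ ≤ C := by
  rw [mem_ball_zero_iff] at hx
  obtain ⟨ρ, h1, h2⟩ := exists_between hx
  obtain ⟨C, hC⟩ := (isCompact_closedBall (0 : E2) ρ).exists_bound_of_continuousOn
    (hG.mono (Metric.closedBall_subset_ball h2))
  refine ⟨C, ρ, h2, by simpa using h1, fun y hy k t ht => ?_⟩
  have := hC _ (Metric.ball_subset_closedBall (smul_mem_ball_of_mem_Icc hy ht))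
  rw [norm_smul, norm_pow, Real.norm_eq_abs, abs_of_nonneg ht.1]
  exact (mul_le_of_le_one_left (norm_nonneg _) (pow_le_one₀ ht.1 ht.2)).trans this

lemma continuousOn_rayMean (k : ℕ) (hG : ContinuousOn G (Metric.ball 0 1)) :
    ContinuousOn (rayMean k G) (Metric.ball 0 1) := by
  intro x hx
  obtain ⟨C, ρ, hρ, hxρ, hC⟩ := exists_local_bound_ray hG hx
  refine ContinuousAt.continuousWithinAt ?_
  refine intervalIntegral.continuousAt_of_dominated_interval (bound := fun _ => C) ?_ ?_
    (by simp) ?_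
  · filter_upwards [Metric.isOpen_ball.mem_nhds hx] with y hy
    exact aestronglyMeasurable_ray k hG hy
  · filter_upwards [Metric.isOpen_ball.mem_nhds hxρ] with y hy
    refine ae_of_all _ fun t ht => hC y hy k t ?_
    rw [uIoc_of_le zero_le_one] at ht
    exact Ioc_subset_Icc_self ht
  · refine ae_of_all _ fun t ht => ?_
    rw [uIoc_of_le zero_le_one] at ht
    have h1 : ContinuousAt G (t • x) := hG.continuousAt
      (Metric.isOpen_ball.mem_nhds (smul_mem_ball_of_mem_Icc hx (Ioc_subset_Icc_self ht)))
    have h2 : ContinuousAt (fun y : E2 => G (t • y)) x :=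
      ContinuousAt.comp (f := fun y : E2 => t • y) (g := G) h1 (by fun_prop)
    exact continuousAt_const.smul h2

/-- The chain rule for `t • x` produces one more factor `t`. The derivative is again a ray mean,
which allows iteration to second order. -/
lemma hasFDerivAt_rayMean (k : ℕ) (hG : ContDiffOn ℝ 1 G (Metric.ball 0 1)) {x : E2}
    (hx : x ∈ Metric.ball (0 : E2) 1) :
    HasFDerivAt (rayMean k G) (rayMean (k + 1) (fderiv ℝ G) x) x := by
  have hG' : ContinuousOn (fderiv ℝ G) (Metric.ball 0 1) :=
    hG.continuousOn_fderiv_of_isOpen Metric.isOpen_ball le_rfl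
  obtain ⟨C, ρ, hρ, hxρ, hC⟩ := exists_local_bound_ray hG' hx
  refine intervalIntegral.hasFDerivAt_integral_of_dominated_of_fderiv_le (𝕜 := ℝ)
    (s := Metric.ball 0 ρ) (F' := fun y t => t ^ (k + 1) • fderiv ℝ G (t • y))
    (bound := fun _ => C) (Metric.isOpen_ball.mem_nhds hxρ) ?_ ?_
    (aestronglyMeasurable_ray (k + 1) hG' hx) ?_ (by simp) ?_
  · filter_upwards [Metric.isOpen_ball.mem_nhds hx] with y hy
    exact aestronglyMeasurable_ray k hG.continuousOn hy
  · exact ContinuousOn.intervalIntegrable (by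
      rw [uIcc_of_le zero_le_one]
      exact continuousOn_ray k hG.continuousOn hx)
  · refine ae_of_all _ fun t ht y hy => hC y hy _ t ?_
    rw [uIoc_of_le zero_le_one] at ht
    exact Ioc_subset_Icc_self ht
  · refine ae_of_all _ fun t ht y hy => ?_
    rw [uIoc_of_le zero_le_one] at ht
    have hy1 := smul_mem_ball_of_mem_Icc (Metric.ball_subset_ball hρ.le hy)
      (Ioc_subset_Icc_self ht)
    have h1 : HasFDerivAt G (fderiv ℝ G (t • y)) (t • y) :=
      ((hG.contDiffAt (Metric.isOpen_ball.mem_nhds hy1)).differentiableAt one_ne_zero).hasFDerivAt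
    have h2 : HasFDerivAt (fun y : E2 => t • y) (t • ContinuousLinearMap.id ℝ E2) y :=
      (hasFDerivAt_id y).const_smul t
    have h3 := (h1.comp y h2).const_smul (t ^ k)
    refine h3.congr_fderiv ?_
    ext v
    simp [pow_succ, mul_smul]

lemma contDiffOn_rayMean_one (k : ℕ) (hG : ContDiffOn ℝ 1 G (Metric.ball 0 1)) :
    ContDiffOn ℝ 1 (rayMean k G) (Metric.ball 0 1) := by
  have hG' : ContinuousOn (fderiv ℝ G) (Metric.ball 0 1) :=
    hG.continuousOn_fderiv_of_isOpen Metric.isOpen_ball le_rfl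
  rw [show (1 : WithTop ℕ∞) = 0 + 1 from rfl,
    contDiffOn_succ_iff_fderiv_of_isOpen Metric.isOpen_ball]
  refine ⟨fun x hx => (hasFDerivAt_rayMean k hG hx).differentiableAt.differentiableWithinAt,
    by simp, contDiffOn_zero.2 ?_⟩
  exact (continuousOn_rayMean (k + 1) hG').congr fun x hx => (hasFDerivAt_rayMean k hG hx).fderiv

lemma contDiffOn_rayMean_two (k : ℕ) (hG : ContDiffOn ℝ 2 G (Metric.ball 0 1)) :
    ContDiffOn ℝ 2 (rayMean k G) (Metric.ball 0 1) := by
  have hG1 : ContDiffOn ℝ 1 G (Metric.ball 0 1) := hG.of_le (by norm_num)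
  rw [show (2 : WithTop ℕ∞) = 1 + 1 by norm_num,
    contDiffOn_succ_iff_fderiv_of_isOpen Metric.isOpen_ball]
  refine ⟨fun x hx => (hasFDerivAt_rayMean k hG1 hx).differentiableAt.differentiableWithinAt,
    by simp, ?_⟩
  exact (contDiffOn_rayMean_one (k + 1) (hG.fderiv_of_isOpen Metric.isOpen_ball
    (by norm_num))).congr fun x hx => (hasFDerivAt_rayMean k hG1 hx).fderiv

/-- Integrate the derivative of `t² G(t x)` over `[0, 1]`. In the plane the relation says that `x ↦
rayMean 1 G x • x` has divergence `G`. -/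
lemma fderiv_rayMean_self {G : E2 → ℝ} (hG : ContDiffOn ℝ 1 G (Metric.ball 0 1)) {x : E2}
    (hx : x ∈ Metric.ball (0 : E2) 1) :
    fderiv ℝ (rayMean 1 G) x x = G x - 2 * rayMean 1 G x := by
  have hG' : ContinuousOn (fderiv ℝ G) (Metric.ball 0 1) :=
    hG.continuousOn_fderiv_of_isOpen Metric.isOpen_ball le_rfl
  have c1 : IntervalIntegrable (fun t : ℝ => t ^ 2 • fderiv ℝ G (t • x)) volume 0 1 :=
    ContinuousOn.intervalIntegrable (by
      rw [uIcc_of_le zero_le_one]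
      exact continuousOn_ray 2 hG' hx)
  have c2 : IntervalIntegrable (fun t : ℝ => t ^ 1 • G (t • x)) volume 0 1 :=
    ContinuousOn.intervalIntegrable (by
      rw [uIcc_of_le zero_le_one]
      exact continuousOn_ray 1 hG.continuousOn hx)
  have c3 : IntervalIntegrable (fun t : ℝ => (t ^ 2 • fderiv ℝ G (t • x)) x) volume 0 1 :=
    ContinuousOn.intervalIntegrable (by
      rw [uIcc_of_le zero_le_one]
      exact (continuousOn_ray 2 hG' hx).clm_apply continuousOn_const)
  have e1 : fderiv ℝ (rayMean 1 G) x x =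
      ∫ t in (0 : ℝ)..1, (t ^ 2 • fderiv ℝ G (t • x)) x := by
    rw [(hasFDerivAt_rayMean 1 hG hx).fderiv, rayMean,
      ContinuousLinearMap.intervalIntegral_apply c1]
  have e2 : ∫ t in (0 : ℝ)..1, ((t ^ 2 • fderiv ℝ G (t • x)) x + 2 * (t ^ 1 • G (t • x))) =
      (1 : ℝ) ^ 2 * G ((1 : ℝ) • x) - (0 : ℝ) ^ 2 * G ((0 : ℝ) • x) := by
    refine intervalIntegral.integral_eq_sub_of_hasDerivAt (f := fun t : ℝ => t ^ 2 * G (t • x))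
      (fun t ht => ?_) (c3.add (c2.const_mul 2))
    rw [uIcc_of_le zero_le_one] at ht
    have hy1 := smul_mem_ball_of_mem_Icc hx ht
    have h1 : HasFDerivAt G (fderiv ℝ G (t • x)) (t • x) :=
      ((hG.contDiffAt (Metric.isOpen_ball.mem_nhds hy1)).differentiableAt one_ne_zero).hasFDerivAt
    have h2 : HasDerivAt (fun t : ℝ => t • x) x t := by
      simpa using (hasDerivAt_id t).smul_const x
    have h3 := (hasDerivAt_pow 2 t).mul (h1.comp_hasDerivAt t h2)
    refine h3.congr_deriv ?_
    simp
    ring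
  rw [intervalIntegral.integral_add c3 (c2.const_mul 2), intervalIntegral.integral_const_mul] at e2
  rw [e1, rayMean]
  simp only [one_pow, one_mul, one_smul] at e2
  linarith

end RayMean

/-! ### Radial functions -/

/-- The rotation of the plane by a right angle. -/
def quarterTurn (x : E2) : E2 := !₂[-x 1, x 0]

/-- A function which depends on the norm only, on the closed unit disc. -/
def IsRadialOnDisc (G : E2 → ℝ) : Prop :=
  ∀ a ∈ Metric.closedBall (0 : E2) 1, ∀ b ∈ Metric.closedBall (0 : E2) 1, ‖a‖ = ‖b‖ → G a = G b

/-- Differentiate the constant function `G` along the circle through `x`, at angle zero. -/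
lemma fderiv_quarterTurn {G : E2 → ℝ} (hr : IsRadialOnDisc G) {x : E2}
    (hx : x ∈ Metric.ball (0 : E2) 1) (hd : DifferentiableAt ℝ G x) :
    fderiv ℝ G x (quarterTurn x) = 0 := by
  have hn : ∀ θ : ℝ, ‖Real.cos θ • x + Real.sin θ • quarterTurn x‖ = ‖x‖ := by
    intro θ
    rw [EuclideanSpace.norm_eq, EuclideanSpace.norm_eq]
    congr 1
    simp [Fin.sum_univ_two, quarterTurn]
    linear_combination (x 0 ^ 2 + x 1 ^ 2) * Real.sin_sq_add_cos_sq θ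
  have h1 : HasDerivAt (fun θ : ℝ => Real.cos θ • x + Real.sin θ • quarterTurn x)
      (quarterTurn x) 0 := by
    have := ((Real.hasDerivAt_cos 0).smul_const x).add
      ((Real.hasDerivAt_sin 0).smul_const (quarterTurn x))
    exact this.congr_deriv (by simp)
  have h0 : Real.cos 0 • x + Real.sin 0 • quarterTurn x = x := by simp
  have h2 : HasDerivAt (fun θ : ℝ => G (Real.cos θ • x + Real.sin θ • quarterTurn x))
      (fderiv ℝ G x (quarterTurn x)) 0 := by
    refine HasFDerivAt.comp_hasDerivAt (0 : ℝ) (l := G) ?_ h1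
    rw [h0]
    exact hd.hasFDerivAt
  have hx1 := mem_ball_zero_iff.1 hx
  have h3 : (fun θ : ℝ => G (Real.cos θ • x + Real.sin θ • quarterTurn x)) = fun _ => G x := by
    funext θ
    exact hr _ (by rw [mem_closedBall_zero_iff, hn]; exact hx1.le) _
      (Metric.ball_subset_closedBall hx) (hn θ)
  rw [h3] at h2
  exact h2.unique (hasDerivAt_const _ _)

lemma IsRadialOnDisc.rayMean {G : E2 → ℝ} (hr : IsRadialOnDisc G) (k : ℕ) :
    IsRadialOnDisc (rayMean k G) := by
  intro a ha b hb hab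
  refine intervalIntegral.integral_congr fun t ht => ?_
  rw [uIcc_of_le zero_le_one] at ht
  rw [mem_closedBall_zero_iff] at ha hb
  have h : ∀ c : E2, ‖c‖ ≤ 1 → t • c ∈ Metric.closedBall (0 : E2) 1 := by
    intro c hc
    rw [mem_closedBall_zero_iff, norm_smul, Real.norm_eq_abs, abs_of_nonneg ht.1]
    exact mul_le_one₀ ht.2 (norm_nonneg _) hc
  change t ^ k • G (t • a) = t ^ k • G (t • b)
  rw [hr _ (h a ha) _ (h b hb) (by rw [norm_smul, norm_smul, hab])]

lemma norm_axis (r : ℝ) : ‖(!₂[r, 0] : E2)‖ = |r| := by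
  rw [EuclideanSpace.norm_eq]
  simp [Fin.sum_univ_two, Real.sqrt_sq_eq_abs]

/-- Radial symmetry moves `x` to the axis, where it is compared with the boundary point `(1, 0)`;
then `1 - r ≤ 1 - r²`. -/
lemma abs_le_of_lipschitz_radial {G : E2 → ℝ} (hr : IsRadialOnDisc G) {K : NNReal}
    (hL : LipschitzOnWith K G (Metric.closedBall 0 1)) (h1 : G !₂[1, 0] = 0) {x : E2}
    (hx : x ∈ Metric.ball (0 : E2) 1) : |G x| ≤ K * (1 - ‖x‖ ^ 2) := by
  have hx1 := mem_ball_zero_iff.1 hx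
  have m1 : (!₂[1, 0] : E2) ∈ Metric.closedBall (0 : E2) 1 := by
    rw [mem_closedBall_zero_iff, norm_axis]; simp
  have m2 : (!₂[‖x‖, 0] : E2) ∈ Metric.closedBall (0 : E2) 1 := by
    rw [mem_closedBall_zero_iff, norm_axis]; simpa using hx1.le
  have e : G x = G !₂[‖x‖, 0] :=
    hr _ (Metric.ball_subset_closedBall hx) _ m2 (by rw [norm_axis, abs_norm])
  have := hL.norm_sub_le m2 m1
  rw [h1, sub_zero, ← e, Real.norm_eq_abs] at this
  have e2 : (!₂[‖x‖, 0] - !₂[1, 0] : E2) = !₂[‖x‖ - 1, 0] := by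
    ext i; fin_cases i <;> simp
  rw [e2, norm_axis, abs_of_nonpos (show ‖x‖ - 1 ≤ 0 by linarith)] at this
  refine this.trans (mul_le_mul_of_nonneg_left ?_ K.coe_nonneg)
  nlinarith [norm_nonneg x]

/-- Both the contraction by `t` and the weight `t ^ k` only improve the constant. -/
lemma LipschitzOnWith.rayMean {G : E2 → ℝ} {K : NNReal}
    (hL : LipschitzOnWith K G (Metric.closedBall 0 1)) (k : ℕ) :
    LipschitzOnWith K (rayMean k G) (Metric.closedBall 0 1) := by
  have hm : ∀ c ∈ Metric.closedBall (0 : E2) 1, ∀ t ∈ Icc (0 : ℝ) 1,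
      t • c ∈ Metric.closedBall (0 : E2) 1 := by
    intro c hc t ht
    rw [mem_closedBall_zero_iff] at hc ⊢
    rw [norm_smul, Real.norm_eq_abs, abs_of_nonneg ht.1]
    exact mul_le_one₀ ht.2 (norm_nonneg _) hc
  have hi : ∀ c ∈ Metric.closedBall (0 : E2) 1,
      IntervalIntegrable (fun t : ℝ => t ^ k • G (t • c)) volume 0 1 := fun c hc =>
    ContinuousOn.intervalIntegrable (by
      rw [uIcc_of_le zero_le_one]
      exact (continuousOn_pow k).smul (hL.continuousOn.comp (by fun_prop) (hm c hc)))
  refine LipschitzOnWith.of_dist_le_mul fun a ha b hb => ?_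
  rw [dist_eq_norm, dist_eq_norm, ElasticGap.rayMean, ElasticGap.rayMean,
    ← intervalIntegral.integral_sub (hi a ha) (hi b hb)]
  have := intervalIntegral.norm_integral_le_of_norm_le_const (a := (0 : ℝ)) (b := 1)
    (f := fun t : ℝ => t ^ k • G (t • a) - t ^ k • G (t • b)) (C := K * ‖a - b‖) (fun t ht => by
      rw [uIoc_of_le zero_le_one] at ht
      have ht' := Ioc_subset_Icc_self ht
      have h1 := hL.norm_sub_le (hm a ha t ht') (hm b hb t ht')
      rw [← smul_sub, norm_smul, norm_pow, Real.norm_eq_abs t, abs_of_nonneg ht'.1]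
      rw [← smul_sub, norm_smul, Real.norm_eq_abs t, abs_of_nonneg ht'.1] at h1
      refine (mul_le_of_le_one_left (norm_nonneg _) (pow_le_one₀ ht'.1 ht'.2)).trans
        (h1.trans (mul_le_mul_of_nonneg_left ?_ K.coe_nonneg))
      exact mul_le_of_le_one_left (norm_nonneg _) ht'.2)
  simpa using this

/-! ### The horizontal potential -/

namespace IsHorizontalPotential

variable {φ : E2 → ℝ}

lemma contDiffOn_ball (hφ : IsHorizontalPotential φ) : ContDiffOn ℝ 2 φ (Metric.ball 0 1) :=
  hφ.smooth.mono Metric.ball_subset_closedBall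

lemma exists_lipschitz (hφ : IsHorizontalPotential φ) :
    ∃ K : NNReal, LipschitzOnWith K φ (Metric.closedBall 0 1) := by
  have hu : UniqueDiffOn ℝ (Metric.closedBall (0 : E2) 1) :=
    uniqueDiffOn_convex (convex_closedBall 0 1)
      ((Metric.nonempty_ball.2 one_pos).mono Metric.ball_subset_interior_closedBall)
  obtain ⟨C, hC⟩ := (isCompact_closedBall (0 : E2) 1).exists_bound_of_continuousOn
    (hφ.smooth.continuousOn_fderivWithin hu (by norm_num))
  exact ⟨C.toNNReal, Convex.lipschitzOnWith_of_nnnorm_fderivWithin_le (𝕜 := ℝ)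
    (hφ.smooth.differentiableOn (by norm_num))
    (fun x hx => by
      rw [← NNReal.coe_le_coe, coe_nnnorm]
      exact (hC x hx).trans (Real.le_coe_toNNReal C)) (convex_closedBall 0 1)⟩

/-- This value is `∫ r φ(r) dr`. Integrating the derivative of `r² φ(r)`, with `φ(1) = 0`, turns it
into `-½ ∫ r² φ'(r) dr`, which is zero by the moment condition. -/
lemma rayMean_one (hφ : IsHorizontalPotential φ) : rayMean 1 φ !₂[1, 0] = 0 := by
  have hax : ContDiff ℝ 2 (fun r : ℝ => (!₂[r, 0] : E2)) := by
    refine contDiff_euclidean.2 fun i => ?_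
    fin_cases i
    · exact contDiff_id
    · exact contDiff_const
  have hp : ContDiffOn ℝ 2 (profile φ) (Icc 0 1) :=
    hφ.smooth.comp hax.contDiffOn fun r hr => by
      rw [mem_closedBall_zero_iff, norm_axis, abs_of_nonneg hr.1]
      exact hr.2
  have hu : UniqueDiffOn ℝ (Icc (0 : ℝ) 1) := uniqueDiffOn_Icc one_pos
  have hpd := hp.continuousOn_derivWithin hu (by norm_num)
  have c1 : IntervalIntegrable (fun r : ℝ => r ^ 2 * derivWithin (profile φ) (Icc 0 1) r)
      volume 0 1 := ContinuousOn.intervalIntegrable (by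
        rw [uIcc_of_le zero_le_one]
        exact (continuousOn_pow 2).mul hpd)
  have c2 : IntervalIntegrable (fun r : ℝ => r * profile φ r) volume 0 1 :=
    ContinuousOn.intervalIntegrable (by
        rw [uIcc_of_le zero_le_one]
        exact continuousOn_id.mul hp.continuousOn)
  have e := intervalIntegral.integral_eq_sub_of_hasDerivAt_of_le (zero_le_one' ℝ)
    (f := fun r => r ^ 2 * profile φ r)
    (f' := fun r => r ^ 2 * derivWithin (profile φ) (Icc 0 1) r + 2 * (r * profile φ r))
    ((continuousOn_pow 2).mul hp.continuousOn)
    (fun r hr => by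
      have h1 := ((hp.differentiableOn (by norm_num)) r (Ioo_subset_Icc_self hr)).hasDerivWithinAt
        |>.hasDerivAt (Icc_mem_nhds hr.1 hr.2)
      refine ((hasDerivAt_pow 2 r).mul h1).congr_deriv ?_
      simp
      ring)
    (c1.add (c2.const_mul 2))
  rw [intervalIntegral.integral_add c1 (c2.const_mul 2), intervalIntegral.integral_const_mul,
    hφ.moment, hφ.profile_one] at e
  have : rayMean 1 φ !₂[1, 0] = ∫ r in (0 : ℝ)..1, r * profile φ r := by
    refine intervalIntegral.integral_congr fun t _ => ?_
    simp only [profile, pow_one, smul_eq_mul]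
    congr 2
    ext i; fin_cases i <;> simp
  rw [this]
  linarith

/-- A potential vanishing on the disc would have zero Laplacian. Nontriviality of `φ` is what makes
the final gap strict. -/
lemma exists_ne_zero (hφ : IsHorizontalPotential φ) : ∃ a ∈ Metric.ball (0 : E2) 1, φ a ≠ 0 := by
  by_contra! h
  obtain ⟨a, ha, hne⟩ := hφ.laplacian_ne
  have : φ =ᶠ[𝓝 a] fun _ => 0 := by
    filter_upwards [Metric.isOpen_ball.mem_nhds ha] with b hb using h b hb
  apply hne
  rw [(InnerProductSpace.laplacian_congr_nhds this).eq_of_nhds]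
  simp

end IsHorizontalPotential

/-! ### Functions of the horizontal variables on the cylinder -/

/-- The projection onto the horizontal plane. -/
def horiz : E3 →L[ℝ] E2 :=
  LinearMap.toContinuousLinearMap
    { toFun := fun x => !₂[x 0, x 1]
      map_add' := fun x y => by ext i; fin_cases i <;> simp
      map_smul' := fun c x => by ext i; fin_cases i <;> simp }

lemma horiz_apply (x : E3) : horiz x = !₂[x 0, x 1] := rfl

lemma horiz_single_two : horiz (EuclideanSpace.single 2 1) = 0 := by
  rw [horiz_apply]; ext i; fin_cases i <;> simp

lemma horiz_eq (x : E3) : horiz x = x 0 • horiz (EuclideanSpace.single 0 1) +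
    x 1 • horiz (EuclideanSpace.single 1 1) := by
  simp only [horiz_apply]; ext i; fin_cases i <;> simp

lemma quarterTurn_horiz (x : E3) : quarterTurn (horiz x) =
    x 0 • horiz (EuclideanSpace.single 1 1) - x 1 • horiz (EuclideanSpace.single 0 1) := by
  simp only [horiz_apply, quarterTurn]; ext i; fin_cases i <;> simp

lemma norm_horiz_sq (x : E3) : ‖horiz x‖ ^ 2 = x 0 ^ 2 + x 1 ^ 2 := by
  rw [horiz_apply, EuclideanSpace.real_norm_sq_eq]
  simp [Fin.sum_univ_two]

lemma norm_horiz_single_le (j : Fin 3) : ‖horiz (EuclideanSpace.single j 1)‖ ≤ 1 := by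
  rw [← sq_le_one_iff₀ (norm_nonneg _), norm_horiz_sq]
  fin_cases j <;> simp

lemma mapsTo_horiz : MapsTo horiz cyl (Metric.ball 0 1) := by
  intro x hx
  rw [mem_ball_zero_iff, ← sq_lt_one_iff₀ (norm_nonneg _), norm_horiz_sq]
  exact hx.1

lemma partialDeriv_comp_horiz {G : E2 → ℝ} {x : E3} (hG : DifferentiableAt ℝ G (horiz x))
    (j : Fin 3) : partialDeriv j (fun x => G (horiz x)) x =
      fderiv ℝ G (horiz x) (horiz (EuclideanSpace.single j 1)) := by
  have := hG.hasFDerivAt.comp x horiz.hasFDerivAt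
  simp only [partialDeriv]
  rw [show (fun x => G (horiz x)) = G ∘ horiz from rfl, this.fderiv]
  rfl

/-- A function of the cylindrical radius only, which vanishes on the lateral boundary of the
cylinder. -/
structure IsRadialField (a : E3 → ℝ) : Prop where
  contDiffOn : ContDiffOn ℝ 2 a cyl
  vertical : ∀ x ∈ cyl, partialDeriv 2 a x = 0
  tangential : ∀ x ∈ cyl, x 0 * partialDeriv 1 a x = x 1 * partialDeriv 0 a x
  bound : ∃ K, 0 ≤ K ∧ (∀ x ∈ cyl, |a x| ≤ K * (1 - x 0 ^ 2 - x 1 ^ 2)) ∧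
    ∀ x ∈ cyl, ∀ j, |partialDeriv j a x| ≤ K

lemma isRadialField_comp_horiz {G : E2 → ℝ} (hG : ContDiffOn ℝ 2 G (Metric.ball 0 1))
    (hr : IsRadialOnDisc G) {K : NNReal} (hL : LipschitzOnWith K G (Metric.closedBall 0 1))
    (h1 : G !₂[1, 0] = 0) : IsRadialField (fun x => G (horiz x)) := by
  have hd : ∀ x ∈ cyl, DifferentiableAt ℝ G (horiz x) := fun x hx =>
    (hG.contDiffAt (Metric.isOpen_ball.mem_nhds (mapsTo_horiz hx))).differentiableAt (by norm_num)
  refine ⟨hG.comp horiz.contDiff.contDiffOn mapsTo_horiz, fun x hx => ?_, fun x hx => ?_,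
    K, K.coe_nonneg, fun x hx => ?_, fun x hx j => ?_⟩
  · rw [partialDeriv_comp_horiz (hd x hx), horiz_single_two, map_zero]
  · have := fderiv_quarterTurn hr (mapsTo_horiz hx) (hd x hx)
    rw [quarterTurn_horiz, map_sub, map_smul, map_smul, smul_eq_mul, smul_eq_mul] at this
    rw [partialDeriv_comp_horiz (hd x hx), partialDeriv_comp_horiz (hd x hx)]
    linarith
  · have := abs_le_of_lipschitz_radial hr hL h1 (mapsTo_horiz hx)
    rw [norm_horiz_sq] at this
    rwa [sub_sub]
  · rw [partialDeriv_comp_horiz (hd x hx)]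
    have hn := norm_fderiv_le_of_lipschitzOn (𝕜 := ℝ) (Filter.mem_of_superset
      (Metric.isOpen_ball.mem_nhds (mapsTo_horiz hx)) Metric.ball_subset_closedBall) hL
    refine ((fderiv ℝ G (horiz x)).le_opNorm _).trans ?_
    exact (mul_le_of_le_one_right (norm_nonneg _) (norm_horiz_single_le j)).trans hn

lemma IsRadialField.symm {a : E3 → ℝ} (ha : IsRadialField a) {x : E3} (hx : x ∈ cyl)
    (i j : Fin 3) :
    partialDeriv i (partialDeriv j a) x = partialDeriv j (partialDeriv i a) x := by
  have hc := ha.contDiffOn.contDiffAt (isOpen_cyl.mem_nhds hx)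
  have hs : IsSymmSndFDerivAt ℝ a x := hc.isSymmSndFDerivAt (by simp)
  have hd : DifferentiableAt ℝ (fderiv ℝ a) x :=
    (hc.fderiv_right (m := 1) (by norm_num)).differentiableAt one_ne_zero
  have : ∀ k l, partialDeriv k (partialDeriv l a) x =
      fderiv ℝ (fderiv ℝ a) x (EuclideanSpace.single k 1) (EuclideanSpace.single l 1) := by
    intro k l
    simp only [partialDeriv]
    rw [show (partialDeriv l a) = fun y => fderiv ℝ a y (EuclideanSpace.single l 1) from rfl,
      fderiv_clm_apply hd (differentiableAt_const _)]
    simp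
  rw [this, this]
  exact hs _ _

lemma IsRadialField.contDiffOn_partialDeriv {a : E3 → ℝ} (ha : IsRadialField a) (j : Fin 3) :
    ContDiffOn ℝ 1 (partialDeriv j a) cyl :=
  (ha.contDiffOn.fderiv_of_isOpen isOpen_cyl (m := 1) (by norm_num)).clm_apply contDiffOn_const

/-- The horizontal potential as a function on the cylinder. -/
def potential (φ : E2 → ℝ) (x : E3) : ℝ := φ (horiz x)

/-- The function `a` on the cylinder for which the divergence of the horizontal field
`a (x, y, 0)` is the potential. -/
def amplitude (φ : E2 → ℝ) (x : E3) : ℝ := rayMean 1 φ (horiz x)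

namespace IsHorizontalPotential

variable {φ : E2 → ℝ}

lemma isRadialField_potential (hφ : IsHorizontalPotential φ) : IsRadialField (potential φ) := by
  obtain ⟨K, hK⟩ := hφ.exists_lipschitz
  exact isRadialField_comp_horiz hφ.contDiffOn_ball hφ.radial hK hφ.profile_one

lemma isRadialField_amplitude (hφ : IsHorizontalPotential φ) : IsRadialField (amplitude φ) := by
  obtain ⟨K, hK⟩ := hφ.exists_lipschitz
  exact isRadialField_comp_horiz (contDiffOn_rayMean_two 1 hφ.contDiffOn_ball)
    (IsRadialOnDisc.rayMean hφ.radial 1) (LipschitzOnWith.rayMean hK 1) hφ.rayMean_one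

/-- The relation `fderiv_rayMean_self` in coordinates: the field `amplitude φ * (x, y, 0)` has
divergence `potential φ`. -/
lemma euler (hφ : IsHorizontalPotential φ) {x : E3} (hx : x ∈ cyl) :
    x 0 * partialDeriv 0 (amplitude φ) x + x 1 * partialDeriv 1 (amplitude φ) x =
      potential φ x - 2 * amplitude φ x := by
  have hd : DifferentiableAt ℝ (rayMean 1 φ) (horiz x) :=
    ((contDiffOn_rayMean_two 1 hφ.contDiffOn_ball).contDiffAt
      (Metric.isOpen_ball.mem_nhds (mapsTo_horiz hx))).differentiableAt (by norm_num)
  have := fderiv_rayMean_self (hφ.contDiffOn_ball.of_le (by norm_num)) (mapsTo_horiz hx)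
  have e : ∀ j, partialDeriv j (amplitude φ) x = _ := fun j => partialDeriv_comp_horiz hd j
  rw [e, e, potential, amplitude, ← this]
  conv_rhs => rw [horiz_eq x, map_add, map_smul, map_smul, ← horiz_eq x]
  simp

lemma force_eq (hφ : IsHorizontalPotential φ) (ψ : ℝ → ℝ) {x : E3} (hx : x ∈ cyl) :
    force φ ψ x = !₂[partialDeriv 0 (potential φ) x, partialDeriv 1 (potential φ) x, ψ (x 2)] := by
  have hd : DifferentiableAt ℝ φ (horiz x) :=
    (hφ.contDiffOn_ball.contDiffAt
      (Metric.isOpen_ball.mem_nhds (mapsTo_horiz hx))).differentiableAt (by norm_num)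
  have e : ∀ j, partialDeriv j (potential φ) x = _ := fun j => partialDeriv_comp_horiz hd j
  have g : ∀ i : Fin 2, gradient φ !₂[x 0, x 1] i =
      fderiv ℝ φ (horiz x) (EuclideanSpace.single i 1) := by
    intro i
    rw [← horiz_apply, ← inner_gradient_left, EuclideanSpace.inner_single_right]
    simp
  have h0 : horiz (EuclideanSpace.single 0 1) = EuclideanSpace.single 0 1 := by
    rw [horiz_apply]; ext i; fin_cases i <;> simp
  have h1 : horiz (EuclideanSpace.single 1 1) = EuclideanSpace.single 1 1 := by
    rw [horiz_apply]; ext i; fin_cases i <;> simp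
  rw [force, g, g, e, e, h0, h1]

lemma exists_potential_ne_zero (hφ : IsHorizontalPotential φ) : ∃ x ∈ cyl, potential φ x ≠ 0 := by
  obtain ⟨b, hb, hne⟩ := hφ.exists_ne_zero
  have hh : horiz !₂[b 0, b 1, 1 / 2] = b := by
    rw [horiz_apply]; ext i; fin_cases i <;> simp
  refine ⟨!₂[b 0, b 1, 1 / 2], ?_, by rwa [potential, hh]⟩
  have h1 : b 0 ^ 2 + b 1 ^ 2 < 1 := by
    have := norm_horiz_sq !₂[b 0, b 1, 1 / 2]
    rw [hh] at this
    have hb' := (sq_lt_one_iff₀ (norm_nonneg b)).2 (mem_ball_zero_iff.1 hb)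
    rw [this] at hb'
    simpa using hb'
  exact ⟨by simpa using h1, by simp, by simp; norm_num⟩

end IsHorizontalPotential

/-! ### The vertical load -/

namespace IsVerticalLoad

variable {ψ : ℝ → ℝ}

/-- The primitive of the vertical load which vanishes at both ends. -/
def primitive (ψ : ℝ → ℝ) (z : ℝ) : ℝ := ∫ t in (0 : ℝ)..z, ψ t

lemma hasDerivAt_integral_of_continuousOn {f : ℝ → ℝ} (hf : ContinuousOn f (Icc 0 1)) {z : ℝ}
    (hz : z ∈ Ioo (0 : ℝ) 1) : HasDerivAt (fun z => ∫ t in (0 : ℝ)..z, f t) (f z) z := by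
  have hz' := Icc_mem_nhds hz.1 hz.2
  refine intervalIntegral.integral_hasDerivAt_right ?_ ?_ (hf.continuousAt hz')
  · refine (hf.mono ?_).intervalIntegrable
    rw [uIcc_of_le hz.1.le]
    exact Icc_subset_Icc_right hz.2.le
  · exact ⟨Icc 0 1, hz', hf.aestronglyMeasurable measurableSet_Icc⟩

lemma contDiffOn_integral {f : ℝ → ℝ} (hf : ContinuousOn f (Icc 0 1)) :
    ContDiffOn ℝ 1 (fun z => ∫ t in (0 : ℝ)..z, f t) (Ioo 0 1) := by
  rw [show (1 : WithTop ℕ∞) = 0 + 1 from rfl, contDiffOn_succ_iff_deriv_of_isOpen isOpen_Ioo]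
  refine ⟨fun z hz => (hasDerivAt_integral_of_continuousOn hf
    hz).differentiableAt.differentiableWithinAt, by simp, contDiffOn_zero.2 ?_⟩
  exact (hf.mono Ioo_subset_Icc_self).congr fun z hz =>
    (hasDerivAt_integral_of_continuousOn hf hz).deriv

lemma continuousOn_primitive (hψ : IsVerticalLoad ψ) : ContinuousOn (primitive ψ) (Icc 0 1) := by
  have hi : IntegrableOn ψ (uIcc 0 1) := by
    rw [uIcc_of_le zero_le_one]
    exact hψ.continuousOn.integrableOn_Icc
  have := intervalIntegral.continuousOn_primitive_interval hi
  rwa [uIcc_of_le zero_le_one] at this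

lemma exists_bound (hψ : IsVerticalLoad ψ) : ∃ K, 0 ≤ K ∧ (∀ z ∈ Icc (0 : ℝ) 1, |ψ z| ≤ K) ∧
    ∀ z ∈ Icc (0 : ℝ) 1, |primitive ψ z| ≤ K * (z * (1 - z)) := by
  obtain ⟨K, hK⟩ := isCompact_Icc.exists_bound_of_continuousOn hψ.continuousOn
  have hK0 : 0 ≤ K := (norm_nonneg _).trans (hK 0 (by simp))
  -- As `ψ` has mean zero, its primitive is bounded by `K z` and by `K (1 - z)`, and `min z (1 - z)
  -- ≤ 2 z (1 - z)`.
  refine ⟨2 * K, by linarith, fun z hz => (hK z hz).trans (by linarith), fun z hz => ?_⟩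
  have hi : ∀ a b, a ∈ Icc (0 : ℝ) 1 → b ∈ Icc (0 : ℝ) 1 → IntervalIntegrable ψ volume a b :=
    fun a b ha hb => (hψ.continuousOn.mono (uIcc_subset_Icc ha hb)).intervalIntegrable
  have h0 : (0 : ℝ) ∈ Icc (0 : ℝ) 1 := by simp
  have h1 : (1 : ℝ) ∈ Icc (0 : ℝ) 1 := by simp
  have hb : ∀ a b, a ∈ Icc (0 : ℝ) 1 → b ∈ Icc (0 : ℝ) 1 → a ≤ b →
      |∫ t in a..b, ψ t| ≤ K * (b - a) := by
    intro a b ha hb hab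
    have := intervalIntegral.norm_integral_le_of_norm_le_const (a := a) (b := b) (f := ψ) (C := K)
      fun t ht => hK t (uIcc_subset_Icc ha hb (uIoc_subset_uIcc ht))
    rwa [abs_of_nonneg (sub_nonneg.2 hab)] at this
  have k1 : |primitive ψ z| ≤ K * z := by simpa [primitive] using hb 0 z h0 hz hz.1
  have k2 : |primitive ψ z| ≤ K * (1 - z) := by
    have e := intervalIntegral.integral_add_adjacent_intervals (hi 0 z h0 hz) (hi z 1 hz h1)
    rw [hψ.integral_zero] at e
    rw [primitive, eq_neg_of_add_eq_zero_left e, abs_neg]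
    exact hb z 1 hz h1 hz.2
  rcases le_total z (1 / 2) with h | h
  · refine k1.trans ?_
    nlinarith [mul_nonneg (mul_nonneg hK0 hz.1) (show 0 ≤ 1 - 2 * z by linarith)]
  · refine k2.trans ?_
    nlinarith [mul_nonneg (mul_nonneg hK0 (sub_nonneg.2 hz.2)) (show 0 ≤ 2 * z - 1 by linarith)]

end IsVerticalLoad

lemma mapsTo_height : MapsTo (fun x : E3 => x 2) cyl (Ioo 0 1) := fun _ hx => ⟨hx.2.1, hx.2.2⟩

lemma height_mem_Icc {x : E3} (hx : x ∈ cyl) : x 2 ∈ Icc (0 : ℝ) 1 := ⟨hx.2.1.le, hx.2.2.le⟩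

/-! ### Bounded functions on the cylinder -/

/-- Boundedness on the cylinder. -/
def BddOnCyl (f : E3 → ℝ) : Prop := ∃ C, ∀ x ∈ cyl, |f x| ≤ C

namespace BddOnCyl

variable {f g : E3 → ℝ}

lemma const (c : ℝ) : BddOnCyl fun _ => c := ⟨|c|, fun _ _ => le_rfl⟩

lemma coord (i : Fin 3) : BddOnCyl fun x => x i := ⟨1, fun _ hx => abs_coord_lt hx i⟩

lemma add (hf : BddOnCyl f) (hg : BddOnCyl g) : BddOnCyl fun x => f x + g x := by
  obtain ⟨C, hC⟩ := hf
  obtain ⟨D, hD⟩ := hg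
  exact ⟨C + D, fun x hx => (abs_add_le _ _).trans (add_le_add (hC x hx) (hD x hx))⟩

lemma mul (hf : BddOnCyl f) (hg : BddOnCyl g) : BddOnCyl fun x => f x * g x := by
  obtain ⟨C, hC⟩ := hf
  obtain ⟨D, hD⟩ := hg
  refine ⟨C * D, fun x hx => ?_⟩
  rw [abs_mul]
  exact mul_le_mul (hC x hx) (hD x hx) (abs_nonneg _) ((abs_nonneg _).trans (hC x hx))

lemma neg (hf : BddOnCyl f) : BddOnCyl fun x => -f x := by
  obtain ⟨C, hC⟩ := hf
  exact ⟨C, fun x hx => by rw [abs_neg]; exact hC x hx⟩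

lemma sub (hf : BddOnCyl f) (hg : BddOnCyl g) : BddOnCyl fun x => f x - g x := by
  simpa only [sub_eq_add_neg] using hf.add hg.neg

lemma memLp (hf : BddOnCyl f) (hc : ContinuousOn f cyl) (q : ℝ≥0∞) :
    MemLp f q (volume.restrict cyl) := by
  obtain ⟨C, hC⟩ := hf
  exact MemLp.of_bound (hc.aestronglyMeasurable measurableSet_cyl) C
    ((ae_restrict_iff' measurableSet_cyl).2 (ae_of_all _ hC))

lemma integrableOn (hf : BddOnCyl f) (hc : ContinuousOn f cyl) : IntegrableOn f cyl := by
  obtain ⟨C, hC⟩ := hf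
  exact integrableOn_of_bound hc hC

lemma exists_uniform {f : Fin 3 → E3 → ℝ} (hf : ∀ i, BddOnCyl (f i)) :
    ∃ C, ∀ x ∈ cyl, ∀ i, |f i x| ≤ C := by
  choose C hC using hf
  exact ⟨∑ i, |C i|, fun x hx i => (hC i x hx).trans ((le_abs_self _).trans
    (Finset.single_le_sum (f := fun i => |C i|) (fun _ _ => abs_nonneg _) (Finset.mem_univ i)))⟩

lemma exists_uniform₂ {f : Fin 3 → Fin 3 → E3 → ℝ} (hf : ∀ i j, BddOnCyl (f i j)) :
    ∃ C, ∀ x ∈ cyl, ∀ i j, |f i j x| ≤ C := by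
  choose C hC using fun i => exists_uniform (hf i)
  exact ⟨∑ i, |C i|, fun x hx i j => (hC i x hx j).trans ((le_abs_self _).trans
    (Finset.single_le_sum (f := fun i => |C i|) (fun _ _ => abs_nonneg _) (Finset.mem_univ i)))⟩

end BddOnCyl

lemma IsRadialField.bddOnCyl {a : E3 → ℝ} (ha : IsRadialField a) : BddOnCyl a := by
  obtain ⟨K, hK0, hK, _⟩ := ha.bound
  refine ⟨K, fun x hx => (hK x hx).trans (mul_le_of_le_one_right hK0 ?_)⟩
  nlinarith [sq_nonneg (x 0), sq_nonneg (x 1)]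

lemma IsRadialField.bddOnCyl_partialDeriv {a : E3 → ℝ} (ha : IsRadialField a) (j : Fin 3) :
    BddOnCyl (partialDeriv j a) := by
  obtain ⟨K, _, _, hK⟩ := ha.bound
  exact ⟨K, fun x hx => hK x hx j⟩

lemma IsVerticalLoad.bddOnCyl {ψ : ℝ → ℝ} (hψ : IsVerticalLoad ψ) :
    BddOnCyl fun x => ψ (x 2) := by
  obtain ⟨K, _, hK, _⟩ := hψ.exists_bound
  exact ⟨K, fun x hx => hK _ (height_mem_Icc hx)⟩

lemma IsVerticalLoad.bddOnCyl_primitive {ψ : ℝ → ℝ} (hψ : IsVerticalLoad ψ) :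
    BddOnCyl fun x => primitive ψ (x 2) := by
  obtain ⟨K, hK0, _, hK⟩ := hψ.exists_bound
  refine ⟨K, fun x hx => (hK _ (height_mem_Icc hx)).trans (mul_le_of_le_one_right hK0 ?_)⟩
  nlinarith [sq_nonneg (x 2), hx.2.1, hx.2.2]

lemma IsVerticalLoad.bddOnCyl_primitive_primitive {ψ : ℝ → ℝ} (hψ : IsVerticalLoad ψ) :
    BddOnCyl fun x => ∫ t in (0 : ℝ)..x 2, primitive ψ t := by
  obtain ⟨C, hC⟩ := isCompact_Icc.exists_bound_of_continuousOn hψ.continuousOn_primitive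
  have hC0 : 0 ≤ C := (norm_nonneg _).trans (hC 0 (by simp))
  refine ⟨C, fun x hx => ?_⟩
  have := intervalIntegral.norm_integral_le_of_norm_le_const (a := (0 : ℝ)) (b := x 2)
    (f := primitive ψ) (C := C) fun t ht => by
      rw [uIoc_of_le hx.2.1.le] at ht
      exact hC t ⟨ht.1.le, ht.2.trans hx.2.2.le⟩
  refine this.trans (mul_le_of_le_one_right hC0 ?_)
  simpa using abs_coord_lt hx 2

/-! ### The equilibrium stress and displacement of the rotated loads -/

/-- The equilibrium stress for the loads rotated by the angle with cosine `c` and sine `s`. -/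
def stress (φ : E2 → ℝ) (ψ : ℝ → ℝ) (c s : ℝ) (x : E3) : M3 :=
  !![-c * (amplitude φ x + x 0 * partialDeriv 0 (amplitude φ) x) +
        2 * s * (x 1 * partialDeriv 0 (amplitude φ) x),
      -c * (x 1 * partialDeriv 0 (amplitude φ) x) +
        s * (x 1 * partialDeriv 1 (amplitude φ) x - x 0 * partialDeriv 0 (amplitude φ) x), 0;
    -c * (x 0 * partialDeriv 1 (amplitude φ) x) +
        s * (x 1 * partialDeriv 1 (amplitude φ) x - x 0 * partialDeriv 0 (amplitude φ) x),
      -c * (amplitude φ x + x 1 * partialDeriv 1 (amplitude φ) x) -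
        2 * s * (x 0 * partialDeriv 1 (amplitude φ) x), 0;
    0, 0, -IsVerticalLoad.primitive ψ (x 2)]

/-- The equilibrium displacement for the loads rotated by the angle with cosine `c` and
sine `s`. -/
def displacement (φ : E2 → ℝ) (ψ : ℝ → ℝ) (c s : ℝ) (x : E3) : E3 :=
  !₂[-(c / 8) * (amplitude φ x * x 0) + (s / 4) * (amplitude φ x * x 1),
    -(c / 8) * (amplitude φ x * x 1) - (s / 4) * (amplitude φ x * x 0),
    -(1 / 8) * ∫ t in (0 : ℝ)..x 2, IsVerticalLoad.primitive ψ t]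

/-- The loads rotated by the angle with cosine `c` and sine `s`. -/
def rotForce (φ : E2 → ℝ) (ψ : ℝ → ℝ) (c s : ℝ) (x : E3) : Fin 3 → ℝ :=
  ![c * partialDeriv 0 (potential φ) x - s * partialDeriv 1 (potential φ) x,
    s * partialDeriv 0 (potential φ) x + c * partialDeriv 1 (potential φ) x, ψ (x 2)]

lemma partialDeriv_comp_height {f : ℝ → ℝ} {f' : ℝ} {x : E3} (hf : HasDerivAt f f' (x 2))
    (j : Fin 3) : partialDeriv j (fun x => f (x 2)) x = if j = 2 then f' else 0 := by
  rw [partialDeriv_comp (v := fun x => x 2) hf.differentiableAt (by fun_prop), hf.deriv,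
    partialDeriv_coord]
  simp [eq_comm]

lemma IsVerticalLoad.contDiffOn_primitive_height {ψ : ℝ → ℝ} (hψ : IsVerticalLoad ψ) :
    ContDiffOn ℝ 1 (fun x : E3 => IsVerticalLoad.primitive ψ (x 2)) cyl :=
  (IsVerticalLoad.contDiffOn_integral hψ.continuousOn).comp (contDiff_coord 1 2).contDiffOn
    mapsTo_height

lemma IsVerticalLoad.contDiffOn_primitive_primitive {ψ : ℝ → ℝ} (hψ : IsVerticalLoad ψ) :
    ContDiffOn ℝ 1 (fun x : E3 => ∫ t in (0 : ℝ)..x 2, IsVerticalLoad.primitive ψ t) cyl :=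
  (IsVerticalLoad.contDiffOn_integral hψ.continuousOn_primitive).comp
    (contDiff_coord 1 2).contDiffOn mapsTo_height

section Fields

variable {φ : E2 → ℝ} {ψ : ℝ → ℝ}

lemma contDiffOn_stress (hφ : IsHorizontalPotential φ) (hψ : IsVerticalLoad ψ) (c s : ℝ)
    (i j : Fin 3) : ContDiffOn ℝ 1 (fun x => stress φ ψ c s x i j) cyl := by
  have ha := hφ.isRadialField_amplitude
  have h := ha.contDiffOn.of_le (show (1 : WithTop ℕ∞) ≤ 2 by norm_num)
  have h0 := ha.contDiffOn_partialDeriv 0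
  have h1 := ha.contDiffOn_partialDeriv 1
  have hp := hψ.contDiffOn_primitive_height
  fin_cases i <;> fin_cases j <;> simp [stress] <;> fun_prop

lemma contDiffOn_displacement (hφ : IsHorizontalPotential φ) (hψ : IsVerticalLoad ψ) (c s : ℝ)
    (i : Fin 3) : ContDiffOn ℝ 1 (fun x => displacement φ ψ c s x i) cyl := by
  have ha := hφ.isRadialField_amplitude
  have h := ha.contDiffOn.of_le (show (1 : WithTop ℕ∞) ≤ 2 by norm_num)
  have hp := hψ.contDiffOn_primitive_primitive
  fin_cases i <;> simp [displacement] <;> fun_prop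

/-- The off-diagonal entries contain `x 1 * ∂₀ a` and `x 0 * ∂₁ a` respectively, which agree because
`a` is radial. -/
lemma stress_symm (hφ : IsHorizontalPotential φ) (ψ : ℝ → ℝ) (c s : ℝ) {x : E3} (hx : x ∈ cyl)
    (i j : Fin 3) : stress φ ψ c s x i j = stress φ ψ c s x j i := by
  have := hφ.isRadialField_amplitude.tangential x hx
  fin_cases i <;> fin_cases j <;> simp [stress, this]

lemma exists_bound_stress (hφ : IsHorizontalPotential φ) (hψ : IsVerticalLoad ψ) (c s : ℝ) :
    ∃ C, ∀ x ∈ cyl, ∀ i j, |stress φ ψ c s x i j| ≤ C := by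
  have ha := hφ.isRadialField_amplitude.bddOnCyl
  have h : ∀ i j, BddOnCyl fun x => x i * partialDeriv j (amplitude φ) x := fun i j =>
    (BddOnCyl.coord i).mul (hφ.isRadialField_amplitude.bddOnCyl_partialDeriv j)
  have hp := hψ.bddOnCyl_primitive
  have hc := fun c => BddOnCyl.const c
  refine BddOnCyl.exists_uniform₂ (f := fun i j x => stress φ ψ c s x i j) fun i j => ?_
  fin_cases i <;> fin_cases j
  exacts [((hc (-c)).mul (ha.add (h 0 0))).add ((hc (2 * s)).mul (h 1 0)),
    ((hc (-c)).mul (h 1 0)).add ((hc s).mul ((h 1 1).sub (h 0 0))), hc 0,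
    ((hc (-c)).mul (h 0 1)).add ((hc s).mul ((h 1 1).sub (h 0 0))),
    ((hc (-c)).mul (ha.add (h 1 1))).sub ((hc (2 * s)).mul (h 0 1)), hc 0, hc 0, hc 0, hp.neg]

/-- The `c` part is `-c` times the Hessian of a function with Laplacian `φ`, so its divergence is
`-c ∇φ`. The `s` part is twice the symmetrized gradient of the divergence free field `s a (y, -x)`,
so its divergence is the Laplacian of that field. Both reduce to the differentiated Euler and
tangential relations. -/
lemma div_stress (hφ : IsHorizontalPotential φ) (hψ : IsVerticalLoad ψ) (c s : ℝ) {x : E3}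
    (hx : x ∈ cyl) (i : Fin 3) :
    ∑ j, partialDeriv j (fun x => stress φ ψ c s x i j) x = -rotForce φ ψ c s x i := by
  have ha := hφ.isRadialField_amplitude
  have hn := isOpen_cyl.mem_nhds hx
  have d : DifferentiableAt ℝ (amplitude φ) x :=
    (ha.contDiffOn.contDiffAt hn).differentiableAt (by norm_num)
  have d0 : DifferentiableAt ℝ (partialDeriv 0 (amplitude φ)) x :=
    ((ha.contDiffOn_partialDeriv 0).contDiffAt hn).differentiableAt one_ne_zero
  have d1 : DifferentiableAt ℝ (partialDeriv 1 (amplitude φ)) x :=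
    ((ha.contDiffOn_partialDeriv 1).contDiffAt hn).differentiableAt one_ne_zero
  have df : DifferentiableAt ℝ (potential φ) x :=
    (hφ.isRadialField_potential.contDiffOn.contDiffAt hn).differentiableAt (by norm_num)
  have hsym := ha.symm hx 1 0
  -- the derivatives of the two first order relations
  have e1 : ∀ j, partialDeriv j (fun x => x 0 * partialDeriv 0 (amplitude φ) x +
      x 1 * partialDeriv 1 (amplitude φ) x) x =
      partialDeriv j (fun x => potential φ x - 2 * amplitude φ x) x := fun j =>
    partialDeriv_congr isOpen_cyl (fun y hy => hφ.euler hy) hx j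
  have e2 : ∀ j, partialDeriv j (fun x => x 0 * partialDeriv 1 (amplitude φ) x) x =
      partialDeriv j (fun x => x 1 * partialDeriv 0 (amplitude φ) x) x := fun j =>
    partialDeriv_congr isOpen_cyl (fun y hy => ha.tangential y hy) hx j
  have e10 := e1 0
  have e11 := e1 1
  have e20 := e2 0
  have e21 := e2 1
  simp (disch := fun_prop) only [partialDeriv_add, partialDeriv_sub, partialDeriv_mul,
    partialDeriv_coord, partialDeriv_const] at e10 e11 e20 e21
  rw [Fin.sum_univ_three]
  fin_cases i
  · have s0 : (fun x => stress φ ψ c s x 0 0) = fun x =>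
      -c * (amplitude φ x + x 0 * partialDeriv 0 (amplitude φ) x) +
        2 * s * (x 1 * partialDeriv 0 (amplitude φ) x) := rfl
    have s1 : (fun x => stress φ ψ c s x 0 1) = fun x =>
      -c * (x 1 * partialDeriv 0 (amplitude φ) x) +
        s * (x 1 * partialDeriv 1 (amplitude φ) x - x 0 * partialDeriv 0 (amplitude φ) x) := rfl
    have s2 : (fun x => stress φ ψ c s x 0 2) = fun _ => 0 := rfl
    have hr : rotForce φ ψ c s x 0 =
      c * partialDeriv 0 (potential φ) x - s * partialDeriv 1 (potential φ) x := rfl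
    simp only [Fin.zero_eta]
    rw [s0, s1, s2, hr]
    simp (disch := fun_prop) only [partialDeriv_add, partialDeriv_sub, partialDeriv_mul,
      partialDeriv_coord, partialDeriv_const]
    simp at e10 e11 e20 e21 ⊢
    rw [hsym] at *
    -- The derivatives of Euler's relation supply the potential terms; the derivative of the
    -- tangential relation exchanges the remaining second derivatives.
    linear_combination (-c) * e10 + s * e11 - 2 * s * e20
  · have s0 : (fun x => stress φ ψ c s x 1 0) = fun x =>
      -c * (x 0 * partialDeriv 1 (amplitude φ) x) +
        s * (x 1 * partialDeriv 1 (amplitude φ) x - x 0 * partialDeriv 0 (amplitude φ) x) := rfl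
    have s1 : (fun x => stress φ ψ c s x 1 1) = fun x =>
      -c * (amplitude φ x + x 1 * partialDeriv 1 (amplitude φ) x) -
        2 * s * (x 0 * partialDeriv 1 (amplitude φ) x) := rfl
    have s2 : (fun x => stress φ ψ c s x 1 2) = fun _ => 0 := rfl
    have hr : rotForce φ ψ c s x 1 =
      s * partialDeriv 0 (potential φ) x + c * partialDeriv 1 (potential φ) x := rfl
    simp only [Fin.mk_one]
    rw [s0, s1, s2, hr]
    simp (disch := fun_prop) only [partialDeriv_add, partialDeriv_sub, partialDeriv_mul,
      partialDeriv_coord, partialDeriv_const]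
    simp at e10 e11 e20 e21 ⊢
    rw [hsym] at *
    linear_combination (-s) * e10 - c * e11 - 2 * s * e21
  · have s0 : (fun x => stress φ ψ c s x 2 0) = fun _ => 0 := rfl
    have s1 : (fun x => stress φ ψ c s x 2 1) = fun _ => 0 := rfl
    have s2 : (fun x => stress φ ψ c s x 2 2) = fun x => -IsVerticalLoad.primitive ψ (x 2) := rfl
    have hr : rotForce φ ψ c s x 2 = ψ (x 2) := rfl
    have hp : HasDerivAt (IsVerticalLoad.primitive ψ) (ψ (x 2)) (x 2) :=
      IsVerticalLoad.hasDerivAt_integral_of_continuousOn hψ.continuousOn (mapsTo_height hx)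
    simp only [Fin.reduceFinMk]
    rw [s0, s1, s2, hr, partialDeriv_neg, partialDeriv_comp_height hp, partialDeriv_const,
      partialDeriv_const]
    simp

end Fields

/-! ### The weak form of the equilibrium equations -/

section WeakForm

variable {φ : E2 → ℝ} {ψ : ℝ → ℝ}

lemma continuousOn_rotForce (hφ : IsHorizontalPotential φ) (hψ : IsVerticalLoad ψ) (c s : ℝ)
    (i : Fin 3) : ContinuousOn (fun x => rotForce φ ψ c s x i) cyl := by
  have hf := hφ.isRadialField_potential
  have h0 := (hf.contDiffOn_partialDeriv 0).continuousOn
  have h1 := (hf.contDiffOn_partialDeriv 1).continuousOn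
  have hp : ContinuousOn (fun x : E3 => ψ (x 2)) cyl :=
    hψ.continuousOn.comp (contDiff_coord 0 2).continuous.continuousOn
      fun x hx => height_mem_Icc hx
  fin_cases i
  · exact (h0.const_mul c).sub (h1.const_mul s)
  · exact (h0.const_mul s).add (h1.const_mul c)
  · exact hp

lemma exists_bound_rotForce (hφ : IsHorizontalPotential φ) (hψ : IsVerticalLoad ψ) (c s : ℝ) :
    ∃ C, ∀ x ∈ cyl, ∀ i, |rotForce φ ψ c s x i| ≤ C := by
  have h := hφ.isRadialField_potential.bddOnCyl_partialDeriv
  have hc := fun c => BddOnCyl.const c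
  refine BddOnCyl.exists_uniform (f := fun i x => rotForce φ ψ c s x i) fun i => ?_
  fin_cases i
  exacts [((hc c).mul (h 0)).sub ((hc s).mul (h 1)), ((hc s).mul (h 0)).add ((hc c).mul (h 1)),
    hψ.bddOnCyl]

/-- On the lateral surface the Euler and tangential relations remove all derivatives from the
traction: only multiples of `φ - a` and `φ - 2 a` remain, and both `φ` and `a` are bounded by a
multiple of `1 - r²`. On the bases the traction is the primitive of `ψ`, which vanishes at both
ends. -/
lemma exists_bound_normal_stress (hφ : IsHorizontalPotential φ) (hψ : IsVerticalLoad ψ)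
    (c s : ℝ) : ∃ C, ∀ x ∈ cyl, ∀ i,
      |x 0 * stress φ ψ c s x i 0 + x 1 * stress φ ψ c s x i 1| ≤ C * (1 - x 0 ^ 2 - x 1 ^ 2) ∧
      |stress φ ψ c s x i 2| ≤ C * (x 2 * (1 - x 2)) := by
  obtain ⟨K, hK0, hK, _⟩ := hφ.isRadialField_amplitude.bound
  obtain ⟨L, hL0, hL, _⟩ := hφ.isRadialField_potential.bound
  obtain ⟨K', hK'0, _, hK'⟩ := hψ.exists_bound
  set C := (|c| + |s|) * (L + 2 * K) with hC
  have hC0 : 0 ≤ C := by positivity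
  refine ⟨C + K', fun x hx i => ?_⟩
  have ht : 0 < 1 - x 0 ^ 2 - x 1 ^ 2 := by linarith [hx.1]
  have hq : 0 < x 2 * (1 - x 2) := mul_pos hx.2.1 (by linarith [hx.2.2])
  have hz : |(0 : ℝ)| ≤ (C + K') * (x 2 * (1 - x 2)) := by rw [abs_zero]; positivity
  have hz' : |(0 : ℝ)| ≤ (C + K') * (1 - x 0 ^ 2 - x 1 ^ 2) := by rw [abs_zero]; positivity
  have htan := hφ.isRadialField_amplitude.tangential x hx
  have heul := hφ.euler hx
  have hm : ∀ u y v A : ℝ, |y| ≤ 1 → |v| ≤ A → |u * (y * v)| ≤ |u| * A := fun u y v A hy hv => by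
    rw [abs_mul, abs_mul]
    refine mul_le_mul_of_nonneg_left ?_ (abs_nonneg _)
    exact (mul_le_of_le_one_left (abs_nonneg _) hy).trans hv
  have h1 : |potential φ x - amplitude φ x| ≤ (L + 2 * K) * (1 - x 0 ^ 2 - x 1 ^ 2) := by
    refine (abs_sub _ _).trans ?_
    have := mul_nonneg hK0 ht.le
    linarith [hK x hx, hL x hx]
  have h2 : |potential φ x - 2 * amplitude φ x| ≤ (L + 2 * K) * (1 - x 0 ^ 2 - x 1 ^ 2) := by
    refine (abs_sub _ _).trans ?_
    rw [abs_mul, abs_two]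
    linarith [hK x hx, hL x hx]
  have hfin : ∀ u v : ℝ, |u| ≤ |c| * ((L + 2 * K) * (1 - x 0 ^ 2 - x 1 ^ 2)) →
      |v| ≤ |s| * ((L + 2 * K) * (1 - x 0 ^ 2 - x 1 ^ 2)) →
      |u + v| ≤ (C + K') * (1 - x 0 ^ 2 - x 1 ^ 2) := by
    intro u v hu hv
    refine (abs_add_le _ _).trans ((add_le_add hu hv).trans ?_)
    have := mul_nonneg hK'0 ht.le
    rw [hC]
    linarith
  fin_cases i
  · refine ⟨?_, hz⟩
    have e : x 0 * stress φ ψ c s x 0 0 + x 1 * stress φ ψ c s x 0 1 =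
        (-c) * (x 0 * (potential φ x - amplitude φ x)) +
          s * (x 1 * (potential φ x - 2 * amplitude φ x)) := by
      simp only [stress, Matrix.of_apply, Matrix.cons_val_zero, Matrix.cons_val_one]
      linear_combination (-c * x 0 + s * x 1) * heul + c * x 1 * htan
    simp only [Fin.zero_eta]
    rw [e]
    refine hfin _ _ ?_ (hm _ _ _ _ (abs_coord_lt hx 1) h2)
    rw [← abs_neg c]
    exact hm _ _ _ _ (abs_coord_lt hx 0) h1
  · refine ⟨?_, hz⟩
    have e : x 0 * stress φ ψ c s x 1 0 + x 1 * stress φ ψ c s x 1 1 =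
        (-c) * (x 1 * (potential φ x - amplitude φ x)) +
          (-s) * (x 0 * (potential φ x - 2 * amplitude φ x)) := by
      simp only [stress, Matrix.of_apply, Matrix.cons_val_zero, Matrix.cons_val_one]
      linear_combination (-c * x 1 - s * x 0) * heul - c * x 0 * htan
    simp only [Fin.mk_one]
    rw [e]
    refine hfin _ _ ?_ ?_
    · rw [← abs_neg c]
      exact hm _ _ _ _ (abs_coord_lt hx 1) h1
    · rw [← abs_neg s]
      exact hm _ _ _ _ (abs_coord_lt hx 0) h2
  · constructor
    · have e : x 0 * stress φ ψ c s x 2 0 + x 1 * stress φ ψ c s x 2 1 = 0 := by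
        simp [stress]
      simp only [Fin.reduceFinMk]
      rw [e]
      exact hz'
    · have e : stress φ ψ c s x 2 2 = -IsVerticalLoad.primitive ψ (x 2) := rfl
      simp only [Fin.reduceFinMk]
      rw [e, abs_neg]
      refine (hK' _ (height_mem_Icc hx)).trans (mul_le_mul_of_nonneg_right ?_ hq.le)
      linarith

/-- The Frobenius inner product. -/
def frob (A B : M3) : ℝ := ∑ i, ∑ j, A i j * B i j

lemma frob_self (A : M3) : frob A A = ‖A‖ ^ 2 := by
  rw [Matrix.frobenius_norm_def, ← Real.sqrt_eq_rpow, Real.sq_sqrt (by positivity)]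
  simp [frob, sq]

lemma integrableOn_of_memLp_two {f : E3 → ℝ} (hf : MemLp f 2 (volume.restrict cyl)) :
    IntegrableOn f cyl := hf.integrable (by norm_num)

lemma integrableOn_weakGrad {v : E3 → E3} (hv : v ∈ W1 cyl 2) (i j : Fin 3) :
    IntegrableOn (fun x => weakGrad cyl v x i j) cyl :=
  integrableOn_of_memLp_two (memLp_weakPartial isOpen_cyl hv i j).1

lemma integrableOn_stress_mul (hφ : IsHorizontalPotential φ) (hψ : IsVerticalLoad ψ) (c s : ℝ)
    (i j : Fin 3) {w : E3 → ℝ} (hw : IntegrableOn w cyl) :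
    IntegrableOn (fun x => stress φ ψ c s x i j * w x) cyl := by
  obtain ⟨C, hC⟩ := exists_bound_stress hφ hψ c s
  exact integrableOn_mul_of_bound hw (contDiffOn_stress hφ hψ c s i j).continuousOn
    fun x hx => hC x hx i j

lemma integrableOn_rotForce_mul (hφ : IsHorizontalPotential φ) (hψ : IsVerticalLoad ψ) (c s : ℝ)
    (i : Fin 3) {w : E3 → ℝ} (hw : IntegrableOn w cyl) :
    IntegrableOn (fun x => rotForce φ ψ c s x i * w x) cyl := by
  obtain ⟨C, hC⟩ := exists_bound_rotForce hφ hψ c s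
  exact integrableOn_mul_of_bound hw (continuousOn_rotForce hφ hψ c s i)
    fun x hx => hC x hx i

/-- `integral_weak_div` applied to each row of the stress; the vanishing traction leaves no boundary
term. -/
theorem integral_stress_weakGrad (hφ : IsHorizontalPotential φ) (hψ : IsVerticalLoad ψ) (c s : ℝ)
    {v : E3 → E3} (hv : v ∈ W1 cyl 2) :
    ∫ x in cyl, frob (stress φ ψ c s x) (weakGrad cyl v x) =
      ∫ x in cyl, ∑ i, rotForce φ ψ c s x i * v x i := by
  obtain ⟨C₁, h1⟩ := exists_bound_stress hφ hψ c s
  obtain ⟨C₂, h2⟩ := exists_bound_normal_stress hφ hψ c s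
  obtain ⟨C₃, h3⟩ := exists_bound_rotForce hφ hψ c s
  have hvi : ∀ i, IntegrableOn (fun x => v x i) cyl := fun i => integrableOn_of_memLp_two (hv i).1
  have row : ∀ i, ∫ x in cyl, ∑ j, stress φ ψ c s x i j * weakGrad cyl v x i j =
      ∫ x in cyl, rotForce φ ψ c s x i * v x i := by
    intro i
    have hle : ∀ y A t : ℝ, 0 ≤ t → |y| ≤ A * t → (A = C₂) →
        |y| ≤ max (max C₁ C₂) C₃ * t := fun y A t ht hy hA =>
      hy.trans (mul_le_mul_of_nonneg_right
        (hA ▸ (le_max_right _ _).trans (le_max_left _ _)) ht)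
    have key := integral_weak_div (s := fun j x => stress φ ψ c s x i j)
      (C := max (max C₁ C₂) C₃) (contDiffOn_stress hφ hψ c s i)
      (fun x hx j => (h1 x hx i j).trans ((le_max_left _ _).trans (le_max_left _ _)))
      (fun x hx => hle _ _ _ (by linarith [hx.1]) (h2 x hx i).1 rfl)
      (fun x hx => hle _ _ _ (mul_nonneg hx.2.1.le (by linarith [hx.2.2])) (h2 x hx i).2 rfl)
      (fun x hx => by
        rw [div_stress hφ hψ c s hx, abs_neg]
        exact (h3 x hx i).trans (le_max_right _ _))
      (hvi i) (integrableOn_weakGrad hv i)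
      (fun j => (memLp_weakPartial isOpen_cyl hv i j).2)
    rw [key, ← integral_neg]
    refine setIntegral_congr_fun measurableSet_cyl fun x hx => ?_
    simp only [div_stress hφ hψ c s hx]
    ring
  simp only [frob]
  rw [integral_finsetSum, integral_finsetSum]
  · exact Finset.sum_congr rfl fun i _ => row i
  · exact fun i _ => integrableOn_rotForce_mul hφ hψ c s i (hvi i)
  · exact fun i _ => integrable_finsetSum _ fun j _ =>
      integrableOn_stress_mul hφ hψ c s i j (integrableOn_weakGrad hv i j)

lemma matField_apply (R : M3) (v : E3 → E3) (x : E3) (i : Fin 3) :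
    matField R v x i = ∑ j, R i j * v x j := by
  simp [matField, Matrix.toLpLin_apply, Matrix.mulVec, dotProduct]

lemma inner_eq_sum (a b : E3) : ⟪a, b⟫_ℝ = ∑ i, a i * b i := by
  simp [PiLp.inner_apply, mul_comm]

/-- The rotation is moved to the force as its transpose. -/
lemma load_rotZ (hφ : IsHorizontalPotential φ) (ψ : ℝ → ℝ) (θ : ℝ) (v : E3 → E3) :
    load φ ψ (matField (rotZ θ) v) =
      ∫ x in cyl, ∑ i, rotForce φ ψ (Real.cos θ) (Real.sin θ) x i * v x i := by
  refine setIntegral_congr_fun measurableSet_cyl fun x hx => ?_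
  simp only [inner_eq_sum, hφ.force_eq ψ hx, matField_apply, Fin.sum_univ_three]
  simp [rotZ, rotForce]
  ring

end WeakForm

/-! ### The equilibrium displacement -/

lemma mem_W1_of_bddOnCyl {u : E3 → E3} (hu : ∀ i, ContDiffOn ℝ 1 (fun x => u x i) cyl)
    (hb : ∀ i, BddOnCyl fun x => u x i)
    (hd : ∀ i j, BddOnCyl (partialDeriv j fun x => u x i)) (q : ℝ≥0∞) : u ∈ W1 cyl q := fun i =>
  ⟨(hb i).memLp (hu i).continuousOn q, fun j => ⟨partialDeriv j fun x => u x i,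
    (hd i j).memLp (continuousOn_partialDeriv isOpen_cyl (hu i) j) q,
    isWeakPartial_of_contDiffOn isOpen_cyl (hu i) j⟩⟩

lemma weakGrad_ae_eq {u : E3 → E3} (hu : ∀ i, ContDiffOn ℝ 1 (fun x => u x i) cyl) :
    ∀ᵐ x ∂volume.restrict cyl, ∀ i j,
      weakGrad cyl u x i j = partialDeriv j (fun y => u y i) x := by
  simp only [ae_all_iff]
  exact fun i j => weakPartial_ae_eq isOpen_cyl (isWeakPartial_of_contDiffOn isOpen_cyl (hu i) j)

section Energy

variable {φ : E2 → ℝ} {ψ : ℝ → ℝ}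

/-- The gradient of the equilibrium displacement. -/
def gradDisplacement (φ : E2 → ℝ) (ψ : ℝ → ℝ) (c s : ℝ) (x : E3) : M3 :=
  !![-(c / 8) * (amplitude φ x + x 0 * partialDeriv 0 (amplitude φ) x) +
        s / 4 * (x 1 * partialDeriv 0 (amplitude φ) x),
      -(c / 8) * (x 0 * partialDeriv 1 (amplitude φ) x) +
        s / 4 * (amplitude φ x + x 1 * partialDeriv 1 (amplitude φ) x), 0;
    -(c / 8) * (x 1 * partialDeriv 0 (amplitude φ) x) -
        s / 4 * (amplitude φ x + x 0 * partialDeriv 0 (amplitude φ) x),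
      -(c / 8) * (amplitude φ x + x 1 * partialDeriv 1 (amplitude φ) x) -
        s / 4 * (x 0 * partialDeriv 1 (amplitude φ) x), 0;
    0, 0, -(1 / 8) * IsVerticalLoad.primitive ψ (x 2)]

lemma partialDeriv_displacement (hφ : IsHorizontalPotential φ) (hψ : IsVerticalLoad ψ) (c s : ℝ)
    {x : E3} (hx : x ∈ cyl) (i j : Fin 3) :
    partialDeriv j (fun x => displacement φ ψ c s x i) x = gradDisplacement φ ψ c s x i j := by
  have ha := hφ.isRadialField_amplitude
  have d : DifferentiableAt ℝ (amplitude φ) x :=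
    (ha.contDiffOn.contDiffAt (isOpen_cyl.mem_nhds hx)).differentiableAt (by norm_num)
  have h2 := ha.vertical x hx
  fin_cases i
  · have e : (fun x => displacement φ ψ c s x 0) = fun x =>
      -(c / 8) * (amplitude φ x * x 0) + (s / 4) * (amplitude φ x * x 1) := rfl
    simp only [Fin.zero_eta]
    rw [e]
    simp (disch := fun_prop) only [partialDeriv_add, partialDeriv_mul, partialDeriv_coord,
      partialDeriv_const]
    fin_cases j <;> simp [gradDisplacement, h2] <;> ring
  · have e : (fun x => displacement φ ψ c s x 1) = fun x =>
      -(c / 8) * (amplitude φ x * x 1) - (s / 4) * (amplitude φ x * x 0) := rfl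
    simp only [Fin.mk_one]
    rw [e]
    simp (disch := fun_prop) only [partialDeriv_sub, partialDeriv_mul, partialDeriv_coord,
      partialDeriv_const]
    fin_cases j <;> simp [gradDisplacement, h2] <;> ring
  · have e : (fun x => displacement φ ψ c s x 2) = fun x =>
      -(1 / 8) * ∫ t in (0 : ℝ)..x 2, IsVerticalLoad.primitive ψ t := rfl
    have hp := (IsVerticalLoad.hasDerivAt_integral_of_continuousOn hψ.continuousOn_primitive
      (mapsTo_height hx)).const_mul (-(1 / 8) : ℝ)
    simp only [Fin.reduceFinMk]
    rw [e, partialDeriv_comp_height hp]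
    fin_cases j <;> simp [gradDisplacement]

lemma bddOnCyl_gradDisplacement (hφ : IsHorizontalPotential φ) (hψ : IsVerticalLoad ψ) (c s : ℝ)
    (i j : Fin 3) : BddOnCyl fun x => gradDisplacement φ ψ c s x i j := by
  have ha := hφ.isRadialField_amplitude.bddOnCyl
  have h : ∀ i j, BddOnCyl fun x => x i * partialDeriv j (amplitude φ) x := fun i j =>
    (BddOnCyl.coord i).mul (hφ.isRadialField_amplitude.bddOnCyl_partialDeriv j)
  have hp := hψ.bddOnCyl_primitive
  have hc := fun c => BddOnCyl.const c
  fin_cases i <;> fin_cases j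
  exacts [((hc _).mul (ha.add (h 0 0))).add ((hc _).mul (h 1 0)),
    ((hc _).mul (h 0 1)).add ((hc _).mul (ha.add (h 1 1))), hc 0,
    ((hc _).mul (h 1 0)).sub ((hc _).mul (ha.add (h 0 0))),
    ((hc _).mul (ha.add (h 1 1))).sub ((hc _).mul (h 0 1)), hc 0, hc 0, hc 0, (hc _).mul hp]

lemma bddOnCyl_displacement (hφ : IsHorizontalPotential φ) (hψ : IsVerticalLoad ψ) (c s : ℝ)
    (i : Fin 3) : BddOnCyl fun x => displacement φ ψ c s x i := by
  have ha := fun i => hφ.isRadialField_amplitude.bddOnCyl.mul (BddOnCyl.coord i)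
  have hc := fun c => BddOnCyl.const c
  fin_cases i
  exacts [((hc _).mul (ha 0)).add ((hc _).mul (ha 1)), ((hc _).mul (ha 1)).sub ((hc _).mul (ha 0)),
    (hc _).mul hψ.bddOnCyl_primitive_primitive]

lemma displacement_mem_W1 (hφ : IsHorizontalPotential φ) (hψ : IsVerticalLoad ψ) (c s : ℝ)
    (q : ℝ≥0∞) : displacement φ ψ c s ∈ W1 cyl q := by
  refine mem_W1_of_bddOnCyl (contDiffOn_displacement hφ hψ c s) (bddOnCyl_displacement hφ hψ c s)
    (fun i j => ?_) q
  obtain ⟨C, hC⟩ := bddOnCyl_gradDisplacement hφ hψ c s i j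
  exact ⟨C, fun x hx => by rw [partialDeriv_displacement hφ hψ c s hx]; exact hC x hx⟩

lemma strain_apply (u : E3 → E3) (x : E3) (i j : Fin 3) :
    strain cyl u x i j = (weakGrad cyl u x j i + weakGrad cyl u x i j) / 2 := by
  simp [strain]
  ring

lemma strain_isSymm (u : E3 → E3) (x : E3) : (strain cyl u x).IsSymm := by
  ext i j
  rw [Matrix.transpose_apply, strain_apply, strain_apply, add_comm]

/-- The factor comes from the constitutive law: the derivative of `4|E|²` is `8 E`. Off the diagonal
the tangential relation identifies the two forms of the mixed entry. -/
lemma strain_displacement (hφ : IsHorizontalPotential φ) (hψ : IsVerticalLoad ψ) (c s : ℝ) :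
    ∀ᵐ x ∂volume.restrict cyl, strain cyl (displacement φ ψ c s) x =
      (1 / 8 : ℝ) • stress φ ψ c s x := by
  filter_upwards [weakGrad_ae_eq (contDiffOn_displacement hφ hψ c s),
    ae_restrict_mem measurableSet_cyl] with x hx hxc
  have ht := hφ.isRadialField_amplitude.tangential x hxc
  ext i j
  rw [strain_apply, hx, hx, partialDeriv_displacement hφ hψ c s hxc,
    partialDeriv_displacement hφ hψ c s hxc]
  fin_cases i <;> fin_cases j <;> simp [stress, gradDisplacement]
  · ring
  · linear_combination (-c / 16) * ht
  · linear_combination (c / 16) * ht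
  · ring

/-! ### Minimization of the energy with rotated loads -/

/-- A symmetric matrix is orthogonal to the skew part of the gradient. -/
lemma frob_stress_strain (hφ : IsHorizontalPotential φ) (ψ : ℝ → ℝ) (c s : ℝ) (u : E3 → E3)
    {x : E3} (hx : x ∈ cyl) : frob (stress φ ψ c s x) (strain cyl u x) =
      frob (stress φ ψ c s x) (weakGrad cyl u x) := by
  simp only [frob, strain_apply, Fin.sum_univ_three]
  rw [stress_symm hφ ψ c s hx 1 0, stress_symm hφ ψ c s hx 2 0, stress_symm hφ ψ c s hx 2 1]
  ring

lemma integrableOn_norm_strain_sq {u : E3 → E3} (hu : u ∈ W1 cyl 2) :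
    IntegrableOn (fun x => ‖strain cyl u x‖ ^ 2) cyl := by
  simp only [← frob_self, frob, strain_apply]
  refine integrable_finsetSum _ fun i _ => integrable_finsetSum _ fun j _ => ?_
  have h : MemLp (fun x => (weakGrad cyl u x j i + weakGrad cyl u x i j) / 2) 2
      (volume.restrict cyl) := by
    have := ((memLp_weakPartial isOpen_cyl hu j i).1.add
      (memLp_weakPartial isOpen_cyl hu i j).1).const_mul (1 / 2 : ℝ)
    refine this.ae_eq (ae_of_all _ fun x => ?_)
    simp only [Pi.add_apply, weakGrad, Matrix.of_apply]
    ring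
  simpa only [sq] using h.integrable_sq

lemma integrableOn_norm_stress_sq (hφ : IsHorizontalPotential φ) (hψ : IsVerticalLoad ψ)
    (c s : ℝ) : IntegrableOn (fun x => ‖stress φ ψ c s x‖ ^ 2) cyl := by
  simp only [← frob_self, frob]
  obtain ⟨C, hC⟩ := exists_bound_stress hφ hψ c s
  exact integrable_finsetSum _ fun i _ => integrable_finsetSum _ fun j _ =>
    integrableOn_stress_mul hφ hψ c s i j (BddOnCyl.integrableOn ⟨C, fun x hx => hC x hx i j⟩
      (contDiffOn_stress hφ hψ c s i j).continuousOn)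

/-- The work of the rotated loads. -/
lemma integral_rotForce (hφ : IsHorizontalPotential φ) (hψ : IsVerticalLoad ψ) (c s : ℝ)
    {v : E3 → E3} (hv : v ∈ W1 cyl 2) :
    IntegrableOn (fun x => frob (stress φ ψ c s x) (strain cyl v x)) cyl ∧
    ∫ x in cyl, ∑ i, rotForce φ ψ c s x i * v x i =
      ∫ x in cyl, frob (stress φ ψ c s x) (strain cyl v x) := by
  have e : EqOn (fun x => frob (stress φ ψ c s x) (strain cyl v x))
      (fun x => frob (stress φ ψ c s x) (weakGrad cyl v x)) cyl := fun x hx =>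
    frob_stress_strain hφ ψ c s v hx
  rw [integrableOn_congr_fun e measurableSet_cyl, setIntegral_congr_fun measurableSet_cyl e,
    integral_stress_weakGrad hφ hψ c s hv]
  refine ⟨?_, rfl⟩
  exact integrable_finsetSum _ fun i _ => integrable_finsetSum _ fun j _ =>
    integrableOn_stress_mul hφ hψ c s i j (integrableOn_weakGrad hv i j)

/-- The energy with rotated loads, on `H¹`. -/
def rotEnergyReal (φ : E2 → ℝ) (ψ : ℝ → ℝ) (c s : ℝ) (v : E3 → E3) : ℝ :=
  4 * (∫ x in cyl, ‖strain cyl v x‖ ^ 2) - ∫ x in cyl, ∑ i, rotForce φ ψ c s x i * v x i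

lemma neg_integral_norm_stress_le (hφ : IsHorizontalPotential φ) (hψ : IsVerticalLoad ψ)
    (c s : ℝ) {v : E3 → E3} (hv : v ∈ W1 cyl 2) :
    -(1 / 16) * ∫ x in cyl, ‖stress φ ψ c s x‖ ^ 2 ≤ rotEnergyReal φ ψ c s v := by
  obtain ⟨hi, he⟩ := integral_rotForce hφ hψ c s hv
  rw [rotEnergyReal, he, ← integral_const_mul, ← integral_const_mul, ← integral_sub
    ((integrableOn_norm_strain_sq hv).const_mul 4) hi]
  refine integral_mono ((integrableOn_norm_stress_sq hφ hψ c s).const_mul _)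
    (((integrableOn_norm_strain_sq hv).const_mul 4).sub hi) fun x => ?_
  simp only [← frob_self, frob, Fin.sum_univ_three]
  -- The square is `(2 z - y / 4)²`, applied entry by entry.
  have h : ∀ y z : ℝ, -(1 / 16) * (y * y) ≤ 4 * (z * z) - y * z := fun y z => by
    nlinarith [sq_nonneg (2 * z - y / 4)]
  have H := fun i j => h (stress φ ψ c s x i j) (strain cyl v x i j)
  linarith [H 0 0, H 0 1, H 0 2, H 1 0, H 1 1, H 1 2, H 2 0, H 2 1, H 2 2]

lemma integral_frob_displacement (hφ : IsHorizontalPotential φ) (hψ : IsVerticalLoad ψ) (c s : ℝ) :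
    ∫ x in cyl, frob (stress φ ψ c s x) (strain cyl (displacement φ ψ c s) x) =
      (1 / 8) * ∫ x in cyl, ‖stress φ ψ c s x‖ ^ 2 := by
  rw [← integral_const_mul]
  refine integral_congr_ae ?_
  filter_upwards [strain_displacement hφ hψ c s] with x hx
  rw [hx, ← frob_self]
  simp only [frob, Finset.mul_sum, Matrix.smul_apply, smul_eq_mul]
  exact Finset.sum_congr rfl fun i _ => Finset.sum_congr rfl fun j _ => by ring

/-- With strain `σ / 8` the two terms are `4 / 64` and `1 / 8` of `∫ |σ|²`, so the lower bound is
attained. -/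
lemma rotEnergyReal_displacement (hφ : IsHorizontalPotential φ) (hψ : IsVerticalLoad ψ)
    (c s : ℝ) : rotEnergyReal φ ψ c s (displacement φ ψ c s) =
      -(1 / 16) * ∫ x in cyl, ‖stress φ ψ c s x‖ ^ 2 := by
  have e : ∫ x in cyl, ‖strain cyl (displacement φ ψ c s) x‖ ^ 2 =
      (1 / 64) * ∫ x in cyl, ‖stress φ ψ c s x‖ ^ 2 := by
    rw [← integral_const_mul]
    refine integral_congr_ae ?_
    filter_upwards [strain_displacement hφ hψ c s] with x hx
    rw [hx, norm_smul, mul_pow]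
    norm_num
  rw [rotEnergyReal, (integral_rotForce hφ hψ c s (displacement_mem_W1 hφ hψ c s 2)).2,
    integral_frob_displacement hφ hψ, e]
  ring

/-- The minimal energy, computed from the work of the loads. -/
lemma rotEnergyReal_displacement_eq_work (hφ : IsHorizontalPotential φ) (hψ : IsVerticalLoad ψ)
    (c s : ℝ) : rotEnergyReal φ ψ c s (displacement φ ψ c s) =
      -(1 / 2) * ∫ x in cyl, ∑ i, rotForce φ ψ c s x i * displacement φ ψ c s x i := by
  rw [(integral_rotForce hφ hψ c s (displacement_mem_W1 hφ hψ c s 2)).2,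
    integral_frob_displacement hφ hψ, rotEnergyReal_displacement hφ hψ]
  ring

/-- The potential is the divergence of the horizontal field with the given amplitude. -/
lemma integral_amplitude_mul (hφ : IsHorizontalPotential φ) {w : E3 → ℝ} {g : Fin 3 → E3 → ℝ}
    (hw : IntegrableOn w cyl) (hg : ∀ j, IntegrableOn (g j) cyl)
    (h : ∀ j, IsWeakPartial cyl j w (g j)) :
    ∫ x in cyl, amplitude φ x * (x 0 * g 0 x + x 1 * g 1 x) =
      -∫ x in cyl, potential φ x * w x := by
  have ha := hφ.isRadialField_amplitude
  have hc := ha.contDiffOn.of_le (show (1 : WithTop ℕ∞) ≤ 2 by norm_num)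
  obtain ⟨K, hK0, hK, _⟩ := ha.bound
  obtain ⟨L, hL⟩ := hφ.isRadialField_potential.bddOnCyl
  -- The horizontal field `a (x, y, 0)`; its normal component on the lateral surface vanishes with
  -- `a`, and it is tangent to the bases.
  let σ : Fin 3 → E3 → ℝ := ![fun x => amplitude φ x * x 0, fun x => amplitude φ x * x 1, fun _ => 0]
  have hσ : ∀ j, ContDiffOn ℝ 1 (σ j) cyl := by
    intro j
    fin_cases j
    · exact hc.mul (contDiff_coord 1 0).contDiffOn
    · exact hc.mul (contDiff_coord 1 1).contDiffOn
    · exact contDiffOn_const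
  have hb : ∀ j, BddOnCyl (σ j) := by
    intro j
    fin_cases j
    exacts [ha.bddOnCyl.mul (.coord 0), ha.bddOnCyl.mul (.coord 1), .const 0]
  obtain ⟨M, hM⟩ := BddOnCyl.exists_uniform hb
  have hdiv : ∀ x ∈ cyl, ∑ j, partialDeriv j (σ j) x = potential φ x := by
    intro x hx
    have d : DifferentiableAt ℝ (amplitude φ) x :=
      (ha.contDiffOn.contDiffAt (isOpen_cyl.mem_nhds hx)).differentiableAt (by norm_num)
    rw [Fin.sum_univ_three]
    change partialDeriv 0 (fun x => amplitude φ x * x 0) x +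
      partialDeriv 1 (fun x => amplitude φ x * x 1) x + partialDeriv 2 (fun _ => 0) x = _
    simp (disch := fun_prop) only [partialDeriv_mul, partialDeriv_coord, partialDeriv_const]
    simp
    linarith [hφ.euler hx]
  have hC : 0 ≤ max (max K M) L := hK0.trans ((le_max_left _ _).trans (le_max_left _ _))
  have key := integral_weak_div (s := σ) (C := max (max K M) L) hσ
    (fun x hx j => (hM x hx j).trans ((le_max_right _ _).trans (le_max_left _ _)))
    (fun x hx => by
      have e : x 0 * σ 0 x + x 1 * σ 1 x = amplitude φ x * (x 0 ^ 2 + x 1 ^ 2) := by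
        simp only [σ, Matrix.cons_val_zero, Matrix.cons_val_one]
        ring
      have ht : 0 ≤ 1 - x 0 ^ 2 - x 1 ^ 2 := by linarith [hx.1]
      rw [e, abs_mul, abs_of_nonneg (by positivity : 0 ≤ x 0 ^ 2 + x 1 ^ 2)]
      refine (mul_le_of_le_one_right (abs_nonneg _) hx.1.le).trans ((hK x hx).trans ?_)
      exact mul_le_mul_of_nonneg_right ((le_max_left _ _).trans (le_max_left _ _)) ht)
    (fun x hx => by
      change |(0 : ℝ)| ≤ _
      rw [abs_zero]
      exact mul_nonneg hC (mul_nonneg hx.2.1.le (by linarith [hx.2.2])))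
    (fun x hx => by
      rw [hdiv x hx]
      exact (hL x hx).trans (le_max_right _ _))
    hw hg h
  have e : ∫ x in cyl, (∑ j, partialDeriv j (σ j) x) * w x = ∫ x in cyl, potential φ x * w x :=
    setIntegral_congr_fun measurableSet_cyl fun x hx => by rw [hdiv x hx]
  rw [← e, ← key]
  refine setIntegral_congr_fun measurableSet_cyl fun x hx => ?_
  simp only [Fin.sum_univ_three]
  simp [σ]
  ring

/-- The minimal energy of the rotated loads. -/
lemma rotEnergyReal_displacement_eq (hφ : IsHorizontalPotential φ) (hψ : IsVerticalLoad ψ)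
    (c s : ℝ) : rotEnergyReal φ ψ c s (displacement φ ψ c s) =
      -(1 / 2) * ((c ^ 2 / 8 + s ^ 2 / 4) * (∫ x in cyl, potential φ x ^ 2) +
        ∫ x in cyl, ψ (x 2) * displacement φ ψ c s x 2) := by
  have ha := hφ.isRadialField_amplitude
  have hf := hφ.isRadialField_potential
  have hfc := hf.contDiffOn.of_le (show (1 : WithTop ℕ∞) ≤ 2 by norm_num)
  -- Testing with the potential itself gives `∫ a x · ∇φ = -∫ φ²`.
  have hX := integral_amplitude_mul hφ (w := potential φ) (g := fun j => partialDeriv j (potential φ))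
    (hf.bddOnCyl.integrableOn hfc.continuousOn)
    (fun j => (hf.bddOnCyl_partialDeriv j).integrableOn
      (continuousOn_partialDeriv isOpen_cyl hfc j))
    (fun j => isWeakPartial_of_contDiffOn isOpen_cyl hfc j)
  have i1 : IntegrableOn (fun x => amplitude φ x * (x 0 * partialDeriv 0 (potential φ) x +
      x 1 * partialDeriv 1 (potential φ) x)) cyl := by
    refine BddOnCyl.integrableOn (ha.bddOnCyl.mul (((BddOnCyl.coord 0).mul
      (hf.bddOnCyl_partialDeriv 0)).add ((BddOnCyl.coord 1).mul (hf.bddOnCyl_partialDeriv 1)))) ?_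
    have h0 := (hf.contDiffOn_partialDeriv 0).continuousOn
    have h1 := (hf.contDiffOn_partialDeriv 1).continuousOn
    have h2 := ha.contDiffOn.continuousOn
    fun_prop
  have i2 : IntegrableOn (fun x => ψ (x 2) * displacement φ ψ c s x 2) cyl :=
    integrableOn_rotForce_mul hφ hψ c s 2 ((bddOnCyl_displacement hφ hψ c s 2).integrableOn
      (contDiffOn_displacement hφ hψ c s 2).continuousOn)
  -- The mixed terms in `c s` are multiples of `x φ_y - y φ_x`, which is zero for radial `φ`. The
  -- pure ones are multiples of `a x · ∇φ`.
  have e : ∫ x in cyl, ∑ i, rotForce φ ψ c s x i * displacement φ ψ c s x i =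
      ∫ x in cyl, (-(c ^ 2 / 8 + s ^ 2 / 4) * (amplitude φ x *
        (x 0 * partialDeriv 0 (potential φ) x + x 1 * partialDeriv 1 (potential φ) x)) +
        ψ (x 2) * displacement φ ψ c s x 2) := by
    refine setIntegral_congr_fun measurableSet_cyl fun x hx => ?_
    have ht := hf.tangential x hx
    simp only [Fin.sum_univ_three]
    simp [rotForce, displacement]
    linear_combination (-c * s / 8) * amplitude φ x * ht
  rw [rotEnergyReal_displacement_eq_work hφ hψ, e, integral_add (i1.const_mul _) i2,
    integral_const_mul, hX]
  simp only [sq]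
  ring

/-- A continuous function with zero square integral would vanish on the whole open cylinder. -/
lemma integral_potential_sq_pos (hφ : IsHorizontalPotential φ) :
    0 < ∫ x in cyl, potential φ x ^ 2 := by
  have hf := hφ.isRadialField_potential
  have hc : ContinuousOn (fun x => potential φ x ^ 2) cyl := hf.contDiffOn.continuousOn.pow 2
  have hi : IntegrableOn (fun x => potential φ x ^ 2) cyl := by
    simp only [sq] at hc ⊢
    exact (hf.bddOnCyl.mul hf.bddOnCyl).integrableOn hc
  refine lt_of_le_of_ne (integral_nonneg fun x => sq_nonneg _) fun h => ?_
  rw [eq_comm, setIntegral_eq_zero_iff_of_nonneg_ae (ae_of_all _ fun x => sq_nonneg _) hi] at h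
  obtain ⟨x, hx, hne⟩ := hφ.exists_potential_ne_zero
  have := Measure.eqOn_open_of_ae_eq h isOpen_cyl hc continuousOn_const hx
  exact hne (by simpa using this)

end Energy

/-! ### The rotation kernel -/

/-- The divergence theorem for `F` times a coordinate vector. That vector is tangent to one part of
the boundary, so `F` needs to vanish only on the other. -/
lemma integral_mul_partialDeriv {F : E3 → ℝ} (hF : ContDiffOn ℝ 1 F cyl) (hb : BddOnCyl F)
    (i : Fin 3) (hd : BddOnCyl (partialDeriv i F)) {K : ℝ} (hK : 0 ≤ K)
    (hlat : i ≠ 2 → ∀ x ∈ cyl, |F x| ≤ K * (1 - x 0 ^ 2 - x 1 ^ 2))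
    (hver : i = 2 → ∀ x ∈ cyl, |F x| ≤ K * (x 2 * (1 - x 2)))
    {w : E3 → ℝ} {g : Fin 3 → E3 → ℝ} (hw : IntegrableOn w cyl) (hg : ∀ j, IntegrableOn (g j) cyl)
    (h : ∀ j, IsWeakPartial cyl j w (g j)) :
    ∫ x in cyl, F x * g i x = -∫ x in cyl, partialDeriv i F x * w x := by
  obtain ⟨C₁, h1⟩ := hb
  obtain ⟨C₂, h2⟩ := hd
  let σ : Fin 3 → E3 → ℝ := fun j x => if j = i then F x else 0
  have hσi : σ i = F := by funext x; simp [σ]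
  have hσ0 : ∀ j, j ≠ i → σ j = fun _ => 0 := fun j hj => by funext x; simp [σ, hj]
  have hK' : K ≤ max (max C₁ C₂) K := le_max_right _ _
  have hC0 : 0 ≤ max (max C₁ C₂) K := hK.trans hK'
  have hdiv : ∀ x, ∑ j, partialDeriv j (σ j) x = partialDeriv i F x := fun x => by
    rw [Finset.sum_eq_single i, hσi]
    · intro j _ hj
      rw [hσ0 j hj, partialDeriv_const]
    · simp
  have key := integral_weak_div (s := σ) (C := max (max C₁ C₂) K)
    (fun j => by
      by_cases hj : j = i
      · rw [hj, hσi]; exact hF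
      · rw [hσ0 j hj]; exact contDiffOn_const)
    (fun x hx j => by
      by_cases hj : j = i
      · rw [hj, hσi]
        exact (h1 x hx).trans ((le_max_left _ _).trans (le_max_left _ _))
      · rw [hσ0 j hj, abs_zero]; exact hC0)
    (fun x hx => by
      have ht : 0 ≤ 1 - x 0 ^ 2 - x 1 ^ 2 := by linarith [hx.1]
      have hx1 : ∀ k, i ≠ 2 → |x k * F x| ≤ max (max C₁ C₂) K * (1 - x 0 ^ 2 - x 1 ^ 2) :=
        fun k hi => by
          rw [abs_mul]
          exact (mul_le_of_le_one_left (abs_nonneg _) (abs_coord_lt hx k)).trans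
            ((hlat hi x hx).trans (mul_le_mul_of_nonneg_right hK' ht))
      fin_cases i
      · simpa [σ] using hx1 0 (by decide)
      · simpa [σ] using hx1 1 (by decide)
      · simpa [σ] using mul_nonneg hC0 ht)
    (fun x hx => by
      have hq : 0 ≤ x 2 * (1 - x 2) := mul_nonneg hx.2.1.le (by linarith [hx.2.2])
      by_cases hi : 2 = i
      · simp only [σ, if_pos hi]
        exact (hver hi.symm x hx).trans (mul_le_mul_of_nonneg_right hK' hq)
      · simp only [σ, if_neg hi, abs_zero]
        exact mul_nonneg hC0 hq)
    (fun x hx => by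
      rw [hdiv]
      exact (h2 x hx).trans ((le_max_right _ _).trans (le_max_left _ _)))
    hw hg h
  simp only [hdiv] at key
  rw [← key]
  congr 1
  funext x
  rw [Finset.sum_eq_single i, hσi]
  · intro j _ hj
    rw [hσ0 j hj, zero_mul]
  · simp

lemma isWeakPartial_coord (i j : Fin 3) :
    IsWeakPartial cyl j (fun x => x i) fun _ => if i = j then 1 else 0 := by
  have := isWeakPartial_of_contDiffOn isOpen_cyl (contDiff_coord 1 i).contDiffOn j
  rwa [show partialDeriv j (fun x => x i) = fun _ => if i = j then (1 : ℝ) else 0 from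
    funext fun x => partialDeriv_coord i j x] at this

section Kernel

variable {φ : E2 → ℝ} {ψ : ℝ → ℝ}

/-- The potential is a divergence; test with the constant `1`. -/
lemma integral_potential (hφ : IsHorizontalPotential φ) : ∫ x in cyl, potential φ x = 0 := by
  have h := integral_amplitude_mul hφ (w := fun _ => 1) (g := fun _ _ => 0)
    (BddOnCyl.integrableOn (.const 1) continuousOn_const) (fun _ => integrableOn_zero)
    (fun j => by
      have := isWeakPartial_of_contDiffOn isOpen_cyl
        (contDiffOn_const (c := (1 : ℝ)) (n := 1) (s := cyl)) j
      rwa [show partialDeriv j (fun _ => (1 : ℝ)) = fun _ => 0 from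
        funext fun x => partialDeriv_const j 1 x] at this)
  simpa using h

lemma integrableOn_coord (i : Fin 3) : IntegrableOn (fun x : E3 => x i) cyl :=
  (BddOnCyl.coord i).integrableOn (contDiff_coord 0 i).continuous.continuousOn

/-- Each force component is the `i`-th derivative of a function vanishing on the relevant boundary:
`φ`, or the primitive of `ψ`. Integrating by parts leaves a multiple of `∫ φ = 0` for horizontal
`i`, and nothing for `i = 2`, `j ≠ 2`. -/
lemma moment_eq_zero (hφ : IsHorizontalPotential φ) (hψ : IsVerticalLoad ψ) {i j : Fin 3}
    (hij : ¬(i = 2 ∧ j = 2)) : ∫ x in cyl, rotForce φ ψ 1 0 x i * x j = 0 := by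
  have hf := hφ.isRadialField_potential
  have hfc := hf.contDiffOn.of_le (show (1 : WithTop ℕ∞) ≤ 2 by norm_num)
  obtain ⟨K, hK0, hK, _⟩ := hf.bound
  have hg : ∀ k, IntegrableOn (fun _ : E3 => if j = k then (1 : ℝ) else 0) cyl := fun k =>
    (BddOnCyl.const _).integrableOn continuousOn_const
  have hor : ∀ k : Fin 3, k ≠ 2 → ∫ x in cyl, partialDeriv k (potential φ) x * x j = 0 := by
    intro k hk
    have h := integral_mul_partialDeriv hfc hf.bddOnCyl k (hf.bddOnCyl_partialDeriv k) hK0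
      (fun _ => hK) (fun h2 => absurd h2 hk) (integrableOn_coord j) hg (isWeakPartial_coord j)
    rw [integral_mul_const, integral_potential hφ, zero_mul] at h
    linarith
  fin_cases i
  · simpa [rotForce] using hor 0 (by decide)
  · simpa [rotForce] using hor 1 (by decide)
  · have hj : j ≠ 2 := fun h => hij ⟨rfl, h⟩
    obtain ⟨K', hK'0, _, hK'⟩ := hψ.exists_bound
    have hd : ∀ x ∈ cyl, partialDeriv 2 (fun x => IsVerticalLoad.primitive ψ (x 2)) x = ψ (x 2) :=
      fun x hx => by
        rw [partialDeriv_comp_height (f := IsVerticalLoad.primitive ψ)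
          (IsVerticalLoad.hasDerivAt_integral_of_continuousOn
          hψ.continuousOn (mapsTo_height hx)), if_pos rfl]
    have h := integral_mul_partialDeriv hψ.contDiffOn_primitive_height hψ.bddOnCyl_primitive 2
      (by
        obtain ⟨C, hC⟩ := hψ.bddOnCyl
        exact ⟨C, fun x hx => by rw [hd x hx]; exact hC x hx⟩) hK'0
      (fun h2 => absurd rfl h2) (fun _ x hx => hK' _ (height_mem_Icc hx)) (integrableOn_coord j) hg
      (isWeakPartial_coord j)
    simp only [if_neg hj, mul_zero, integral_zero] at h
    have e : ∫ x in cyl, partialDeriv 2 (fun x => IsVerticalLoad.primitive ψ (x 2)) x * x j =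
        ∫ x in cyl, rotForce φ ψ 1 0 x 2 * x j :=
      setIntegral_congr_fun measurableSet_cyl fun x hx => by
        simp only
        rw [hd x hx]
        simp [rotForce]
    simp only [Fin.reduceFinMk]
    rw [← e]
    linarith

lemma load_matField_id (hφ : IsHorizontalPotential φ) (hψ : IsVerticalLoad ψ) (A : M3) :
    load φ ψ (matField A fun x => x) = A 2 2 * ∫ x in cyl, ψ (x 2) * x 2 := by
  have e : load φ ψ (matField A fun x => x) =
      ∫ x in cyl, ∑ i, ∑ j, A i j * (rotForce φ ψ 1 0 x i * x j) := by
    refine setIntegral_congr_fun measurableSet_cyl fun x hx => ?_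
    simp only [inner_eq_sum, hφ.force_eq ψ hx, matField_apply, Fin.sum_univ_three]
    simp [rotForce]
    ring
  have hi : ∀ i j, IntegrableOn (fun x => A i j * (rotForce φ ψ 1 0 x i * x j)) cyl := fun i j =>
    (integrableOn_rotForce_mul hφ hψ 1 0 i (integrableOn_coord j)).const_mul _
  rw [e, integral_finsetSum _ fun i _ => integrable_finsetSum _ fun j _ => hi i j]
  simp only [integral_finsetSum _ fun j _ => hi _ j, integral_const_mul]
  simp only [Fin.sum_univ_three]
  rw [moment_eq_zero hφ hψ (i := 0) (j := 0) (by decide),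
    moment_eq_zero hφ hψ (i := 0) (j := 1) (by decide),
    moment_eq_zero hφ hψ (i := 0) (j := 2) (by decide),
    moment_eq_zero hφ hψ (i := 1) (j := 0) (by decide),
    moment_eq_zero hφ hψ (i := 1) (j := 1) (by decide),
    moment_eq_zero hφ hψ (i := 1) (j := 2) (by decide),
    moment_eq_zero hφ hψ (i := 2) (j := 0) (by decide),
    moment_eq_zero hφ hψ (i := 2) (j := 1) (by decide)]
  simp [rotForce]

/-- By Fubini the integral is the area of the disc times the first moment of `ψ`. -/
lemma integral_vertical_moment_pos (hψ : IsVerticalLoad ψ) :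
    0 < ∫ x in cyl, ψ (x 2) * x 2 := by
  let D : Set (Fin 2 → ℝ) := {y | y 0 ^ 2 + y 1 ^ 2 < 1}
  have hDo : IsOpen D := isOpen_lt (by fun_prop) continuous_const
  -- The height, index `2`, is split off as the first factor.
  let e : E3 ≃ᵐ ℝ × (Fin 2 → ℝ) := (MeasurableEquiv.toLp 2 (Fin 3 → ℝ)).symm.trans
    (MeasurableEquiv.piFinSuccAbove (fun _ => ℝ) 2)
  have hmp : MeasurePreserving e volume (volume.prod volume) :=
    (volume_preserving_piFinSuccAbove (fun _ => ℝ) 2).comp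
      (EuclideanSpace.volume_preserving_symm_measurableEquiv_toLp (Fin 3))
  have hcyl : cyl = e ⁻¹' (Ioo 0 1 ×ˢ D) := by
    ext x
    change (x 0 ^ 2 + x 1 ^ 2 < 1 ∧ 0 < x 2 ∧ x 2 < 1) ↔
      (0 < x 2 ∧ x 2 < 1) ∧ x 0 ^ 2 + x 1 ^ 2 < 1
    tauto
  have h := hmp.setIntegral_preimage_emb e.measurableEmbedding
    (fun y => y.1 * ψ y.1 * (fun _ => (1 : ℝ)) y.2) (Ioo 0 1 ×ˢ D)
  rw [← hcyl, setIntegral_prod_mul (fun z => z * ψ z) (fun _ => (1 : ℝ))] at h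
  have e1 : ∫ x in cyl, ψ (x 2) * x 2 =
      ∫ x in cyl, (e x).1 * ψ (e x).1 * (fun _ => (1 : ℝ)) (e x).2 := by
    refine setIntegral_congr_fun measurableSet_cyl fun x _ => ?_
    change ψ (x 2) * x 2 = x 2 * ψ (x 2) * 1
    ring
  have hm := hψ.moment_pos
  rw [intervalIntegral.integral_of_le zero_le_one, integral_Ioc_eq_integral_Ioo] at hm
  rw [e1, h]
  refine mul_pos hm ?_
  have hDb : Bornology.IsBounded D := by
    refine (Metric.isBounded_closedBall (x := (0 : Fin 2 → ℝ)) (r := 1)).subset fun y hy => ?_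
    rw [mem_closedBall_zero_iff, pi_norm_le_iff_of_nonneg zero_le_one]
    have hy' : y 0 ^ 2 + y 1 ^ 2 < 1 := hy
    intro i
    rw [Real.norm_eq_abs, ← sq_le_one_iff_abs_le_one]
    fin_cases i
    · exact le_trans (le_add_of_nonneg_right (sq_nonneg (y 1))) hy'.le
    · exact le_trans (le_add_of_nonneg_left (sq_nonneg (y 0))) hy'.le
  have hDn : D.Nonempty := ⟨0, by simp [D]⟩
  rw [setIntegral_const, smul_eq_mul, mul_one]
  exact ENNReal.toReal_pos (hDo.measure_pos volume hDn).ne' hDb.measure_lt_top.ne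

/-- Unit length of the last row and column annihilates their other entries; the remaining block is a
planar rotation by the argument of `R 0 0 + i R 0 1`. -/
lemma exists_rotZ_eq {R : M3} (hR : R ∈ SO3) (h : R 2 2 = 1) :
    ∃ θ ∈ Icc (-Real.pi) Real.pi, R = rotZ θ := by
  rw [SO3, SetLike.mem_coe, Matrix.mem_specialOrthogonalGroup_iff,
    Matrix.mem_orthogonalGroup_iff] at hR
  obtain ⟨hO, hdet⟩ := hR
  have hO' : R.transpose * R = 1 := mul_eq_one_comm.1 hO
  have row : ∀ i j, ∑ k, R i k * R j k = if i = j then 1 else 0 := fun i j => by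
    have := congrFun (congrFun hO i) j
    simpa [Matrix.mul_apply, Matrix.one_apply] using this
  have col : ∀ i j, ∑ k, R k i * R k j = if i = j then 1 else 0 := fun i j => by
    have := congrFun (congrFun hO' i) j
    simpa [Matrix.mul_apply, Matrix.one_apply] using this
  have r22 := row 2 2
  have c22 := col 2 2
  have r00 := row 0 0
  have r11 := row 1 1
  simp only [Fin.sum_univ_three, h] at r22 c22 r00 r11
  simp at r22 c22 r00 r11
  have z20 : R 2 0 = 0 := by nlinarith [sq_nonneg (R 2 0), sq_nonneg (R 2 1)]
  have z21 : R 2 1 = 0 := by nlinarith [sq_nonneg (R 2 0), sq_nonneg (R 2 1)]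
  have z02 : R 0 2 = 0 := by nlinarith [sq_nonneg (R 0 2), sq_nonneg (R 1 2)]
  have z12 : R 1 2 = 0 := by nlinarith [sq_nonneg (R 0 2), sq_nonneg (R 1 2)]
  rw [Matrix.det_fin_three, h, z20, z21, z02, z12] at hdet
  rw [z02] at r00
  rw [z12] at r11
  -- The sum is the squared length of the two rows of the block minus twice its determinant, that is
  -- `2 - 2`.
  have d1 : (R 1 1 - R 0 0) ^ 2 + (R 1 0 + R 0 1) ^ 2 = 0 := by linarith
  have e11 : R 1 1 = R 0 0 := by nlinarith [sq_nonneg (R 1 1 - R 0 0), sq_nonneg (R 1 0 + R 0 1)]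
  have e10 : R 1 0 = -R 0 1 := by nlinarith [sq_nonneg (R 1 1 - R 0 0), sq_nonneg (R 1 0 + R 0 1)]
  let z : ℂ := ⟨R 0 0, R 0 1⟩
  have hz : ‖z‖ = 1 := by
    rw [← sq_eq_sq₀ (norm_nonneg _) zero_le_one, ← Complex.normSq_eq_norm_sq, Complex.normSq_mk]
    linarith
  have hz0 : z ≠ 0 := fun h0 => by simp [h0] at hz
  have hc : Real.cos z.arg = R 0 0 := by rw [Complex.cos_arg hz0, hz, div_one]
  have hs : Real.sin z.arg = R 0 1 := by rw [Complex.sin_arg, hz, div_one]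
  refine ⟨z.arg, ⟨(Complex.neg_pi_lt_arg z).le, Complex.arg_le_pi z⟩, ?_⟩
  ext i j
  fin_cases i <;> fin_cases j <;> simp [rotZ, hc, hs, h, z20, z21, z02, z12, e11, e10]

lemma rotZ_mem_SO3 (θ : ℝ) : rotZ θ ∈ SO3 := by
  rw [SO3, SetLike.mem_coe, Matrix.mem_specialOrthogonalGroup_iff, Matrix.mem_orthogonalGroup_iff]
  have := Real.sin_sq_add_cos_sq θ
  constructor
  · ext i j
    fin_cases i <;> fin_cases j <;> simp [rotZ, Matrix.mul_apply, Fin.sum_univ_three] <;>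
      linarith
  · simp [rotZ, Matrix.det_fin_three]
    linarith

/-- The load of `(R - I) x` is `R 2 2 - 1` times a positive moment, so the condition is that `R`
fixes the vertical axis. -/
lemma mem_rotKernel_iff (hφ : IsHorizontalPotential φ) (hψ : IsVerticalLoad ψ) {R : M3} :
    R ∈ rotKernel φ ψ ↔ ∃ θ ∈ Icc (-Real.pi) Real.pi, R = rotZ θ := by
  have hp := integral_vertical_moment_pos hψ
  rw [rotKernel, mem_ofPred_eq, load_matField_id hφ hψ, mul_eq_zero, or_iff_left hp.ne',
    Matrix.sub_apply, Matrix.one_apply_eq, sub_eq_zero]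
  constructor
  · rintro ⟨h1, h2⟩
    exact exists_rotZ_eq h1 h2
  · rintro ⟨θ, _, rfl⟩
    exact ⟨rotZ_mem_SO3 θ, rfl⟩

end Kernel

/-! ### Minimal energies -/

lemma IsArgmin.eq_of_isLeast {A : Set (E3 → E3)} {J : (E3 → E3) → EReal} {u : E3 → E3} {m : EReal}
    (hu : IsArgmin A J u) (hm : IsLeast (J '' A) m) : J u = m := by
  refine le_antisymm ?_ (hm.2 ⟨u, hu.1, rfl⟩)
  obtain ⟨v, hv, hvm⟩ := hm.1
  exact hvm ▸ hu.2 v hv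

lemma exists_isArgmin_of_isLeast {A : Set (E3 → E3)} {J : (E3 → E3) → EReal} {m : EReal}
    (hm : IsLeast (J '' A) m) : ∃ u, IsArgmin A J u := by
  obtain ⟨u, hu, hum⟩ := hm.1
  exact ⟨u, hu, fun v hv => hum ▸ hm.2 ⟨v, hv, rfl⟩⟩

section Minima

variable {φ : E2 → ℝ} {ψ : ℝ → ℝ}

/-- The energy of the equilibrium displacement for the loads rotated by `θ`. -/
def minRotEnergy (φ : E2 → ℝ) (ψ : ℝ → ℝ) (θ : ℝ) : ℝ :=
  rotEnergyReal φ ψ (Real.cos θ) (Real.sin θ) (displacement φ ψ (Real.cos θ) (Real.sin θ))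

lemma rotEnergy_of_mem (hφ : IsHorizontalPotential φ) (ψ : ℝ → ℝ) (θ : ℝ) {v : E3 → E3}
    (hv : v ∈ W1 cyl 2) : rotEnergy φ ψ θ v =
      (rotEnergyReal φ ψ (Real.cos θ) (Real.sin θ) v : EReal) := by
  rw [rotEnergy, if_pos hv, load_rotZ hφ ψ θ v, rotEnergyReal]

lemma minRotEnergy_le (hφ : IsHorizontalPotential φ) (hψ : IsVerticalLoad ψ) (θ : ℝ)
    {v : E3 → E3} (hv : v ∈ W1 cyl 2) :
    minRotEnergy φ ψ θ ≤ rotEnergyReal φ ψ (Real.cos θ) (Real.sin θ) v := by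
  rw [minRotEnergy, rotEnergyReal_displacement hφ hψ]
  exact neg_integral_norm_stress_le hφ hψ _ _ hv

/-- The exponent `q` is irrelevant: the equilibrium displacement belongs to every `W1 cyl q`, and
the energy is infinite off `H¹`. -/
lemma isLeast_rotEnergy (hφ : IsHorizontalPotential φ) (hψ : IsVerticalLoad ψ) (q : ℝ≥0∞)
    (θ : ℝ) : IsLeast (rotEnergy φ ψ θ '' W1 cyl q) (minRotEnergy φ ψ θ : EReal) := by
  refine ⟨⟨_, displacement_mem_W1 hφ hψ (Real.cos θ) (Real.sin θ) q,
    rotEnergy_of_mem hφ ψ θ (displacement_mem_W1 hφ hψ _ _ 2)⟩, ?_⟩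
  rintro _ ⟨v, -, rfl⟩
  by_cases hv : v ∈ W1 cyl 2
  · rw [rotEnergy_of_mem hφ ψ θ hv]
    exact EReal.coe_le_coe_iff.2 (minRotEnergy_le hφ hψ θ hv)
  · rw [rotEnergy, if_neg hv]
    exact le_top

/-- The vertical displacement depends on neither `c` nor `s`, so its work `Y` may be taken at `0`,
`0`. -/
lemma exists_minRotEnergy_eq (hφ : IsHorizontalPotential φ) (hψ : IsVerticalLoad ψ) :
    ∃ A Y : ℝ, 0 < A ∧ ∀ θ, minRotEnergy φ ψ θ =
      -(1 / 2) * ((Real.cos θ ^ 2 / 8 + Real.sin θ ^ 2 / 4) * A + Y) :=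
  ⟨_, ∫ x in cyl, ψ (x 2) * displacement φ ψ 0 0 x 2, integral_potential_sq_pos hφ,
    fun _ => rotEnergyReal_displacement_eq hφ hψ _ _⟩

lemma integral_quadForm_strain {W : M3 → ℝ≥0∞}
    (hQ : ∀ F : M3, F.IsSymm → quadForm W F = 4 * ‖F‖ ^ 2) (v : E3 → E3) :
    ∫ x in cyl, quadForm W (strain cyl v x) = 4 * ∫ x in cyl, ‖strain cyl v x‖ ^ 2 := by
  rw [← integral_const_mul]
  simp only [hQ _ (strain_isSymm v _)]

lemma rotZ_zero : rotZ 0 = 1 := by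
  ext i j
  fin_cases i <;> fin_cases j <;> simp [rotZ]

lemma matField_one (v : E3 → E3) : matField 1 v = v := by
  funext x
  ext i
  simp [matField_apply, Matrix.one_apply]

lemma linEnergy_eq_rotEnergy {W : M3 → ℝ≥0∞}
    (hQ : ∀ F : M3, F.IsSymm → quadForm W F = 4 * ‖F‖ ^ 2) (φ : E2 → ℝ) (ψ : ℝ → ℝ) :
    linEnergy W φ ψ = rotEnergy φ ψ 0 := by
  funext v
  rw [linEnergy, rotEnergy, integral_quadForm_strain hQ, rotZ_zero, matField_one]

lemma load_rotZ_sub_one (hφ : IsHorizontalPotential φ) (hψ : IsVerticalLoad ψ) (θ : ℝ)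
    {v : E3 → E3} (hv : v ∈ W1 cyl 2) :
    load φ ψ (matField (rotZ θ - 1) v) = load φ ψ (matField (rotZ θ) v) - load φ ψ v := by
  have hi : ∀ θ, IntegrableOn (fun x => ⟪force φ ψ x, matField (rotZ θ) v x⟫_ℝ) cyl := by
    intro θ
    have : IntegrableOn (fun x =>
        ∑ i, rotForce φ ψ (Real.cos θ) (Real.sin θ) x i * v x i) cyl :=
      integrable_finsetSum _ fun i _ => integrableOn_rotForce_mul hφ hψ _ _ i
        (integrableOn_of_memLp_two (hv i).1)
    refine this.congr_fun (fun x hx => ?_) measurableSet_cyl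
    simp only [inner_eq_sum, hφ.force_eq ψ hx, matField_apply, Fin.sum_univ_three]
    simp [rotZ, rotForce]
    ring
  have h0 := hi 0
  rw [rotZ_zero, matField_one] at h0
  rw [load, load, load, ← integral_sub (hi θ) h0]
  congr 1
  funext x
  rw [← inner_sub_right]
  congr 1
  simp [matField]

/-- Subtracting the supremum over the kernel amounts to the infimum over `θ` of the rotated
energies. The lower bound `m` also shows that the set is bounded above, so that the real `sSup` is a
true supremum and not a default value. -/
lemma limEnergy_of_mem {W : M3 → ℝ≥0∞}
    (hQ : ∀ F : M3, F.IsSymm → quadForm W F = 4 * ‖F‖ ^ 2)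
    (hφ : IsHorizontalPotential φ) (hψ : IsVerticalLoad ψ) {v : E3 → E3} (hv : v ∈ W1 cyl 2)
    {m : ℝ} (hm : ∀ θ ∈ Icc (-Real.pi) Real.pi,
      m ≤ rotEnergyReal φ ψ (Real.cos θ) (Real.sin θ) v) :
    (m : EReal) ≤ limEnergy W φ ψ v ∧ ∀ θ ∈ Icc (-Real.pi) Real.pi,
      limEnergy W φ ψ v ≤ (rotEnergyReal φ ψ (Real.cos θ) (Real.sin θ) v : EReal) := by
  set S := (fun R => load φ ψ (matField (R - 1) v)) '' rotKernel φ ψ with hS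
  have hle : ∀ y ∈ S, y ≤ 4 * (∫ x in cyl, ‖strain cyl v x‖ ^ 2) - load φ ψ v - m := by
    rintro _ ⟨R, hR, rfl⟩
    obtain ⟨θ, hθ, rfl⟩ := (mem_rotKernel_iff hφ hψ).1 hR
    have := hm θ hθ
    rw [rotEnergyReal, ← load_rotZ hφ ψ θ v] at this
    simp only
    rw [load_rotZ_sub_one hφ hψ θ hv]
    linarith
  have hpi := Real.pi_pos.le
  have hne : S.Nonempty := ⟨_, rotZ 0, (mem_rotKernel_iff hφ hψ).2 ⟨0, by simp [hpi], rfl⟩, rfl⟩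
  rw [limEnergy, if_pos hv, integral_quadForm_strain hQ]
  constructor
  · rw [EReal.coe_le_coe_iff]
    linarith [csSup_le hne hle]
  · intro θ hθ
    have hmem : load φ ψ (matField (rotZ θ - 1) v) ∈ S :=
      ⟨rotZ θ, (mem_rotKernel_iff hφ hψ).2 ⟨θ, hθ, rfl⟩, rfl⟩
    have := le_csSup ⟨_, hle⟩ hmem
    rw [load_rotZ_sub_one hφ hψ θ hv] at this
    rw [EReal.coe_le_coe_iff, rotEnergyReal, ← load_rotZ hφ ψ θ v]
    linarith

end Minima

end ElasticGap

end

/-! ### Comparison of the minima -/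

open ElasticGap

/-- The minimum of a functional `J` over a set `A` is expressed by `IsLeast (J '' A) m`: it is
attained and equal to `m`. -/
theorem proposition5p3
    (W : M3 → ℝ≥0∞) (p : ℝ) (hW : IsAdmissibleDensity W p)
    (hQ : ∀ F : M3, F.IsSymm → quadForm W F = 4 * ‖F‖ ^ 2)
    (φ : E2 → ℝ) (hφ : IsHorizontalPotential φ)
    (ψ : ℝ → ℝ) (hψ : IsVerticalLoad ψ) :
    (∃ u, IsArgmin (W1 cyl (ENNReal.ofReal p))
      (rotEnergy φ ψ 0) u) ∧
    (∃ u, IsArgmin (W1 cyl (ENNReal.ofReal p))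
      (rotEnergy φ ψ (-(Real.pi / 2))) u) ∧
    ∀ u₀ u₁ : E3 → E3,
      IsArgmin (W1 cyl (ENNReal.ofReal p))
        (rotEnergy φ ψ 0) u₀ →
      IsArgmin (W1 cyl (ENNReal.ofReal p))
        (rotEnergy φ ψ (-(Real.pi / 2))) u₁ →
      (∀ θ ∈ Icc (-Real.pi) Real.pi,
        IsLeast (rotEnergy φ ψ θ '' W1 cyl (ENNReal.ofReal p))
          (((Real.cos θ ^ 2 : ℝ) : EReal) * rotEnergy φ ψ 0 u₀ +
            ((Real.sin θ ^ 2 : ℝ) : EReal) *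
              rotEnergy φ ψ (-(Real.pi / 2)) u₁)) ∧
      IsLeast (limEnergy W φ ψ '' W1 cyl (ENNReal.ofReal p))
        (rotEnergy φ ψ (-(Real.pi / 2)) u₁) ∧
      IsLeast {m : EReal | ∃ θ ∈ Icc (-Real.pi) Real.pi,
          IsLeast (rotEnergy φ ψ θ ''
            W1 cyl (ENNReal.ofReal p)) m}
        (rotEnergy φ ψ (-(Real.pi / 2)) u₁) ∧
      rotEnergy φ ψ (-(Real.pi / 2)) u₁ < rotEnergy φ ψ 0 u₀ ∧
      IsLeast (linEnergy W φ ψ '' W1 cyl (ENNReal.ofReal p))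
        (rotEnergy φ ψ 0 u₀) := by
  set q := ENNReal.ofReal p
  have hmin := isLeast_rotEnergy hφ hψ q
  obtain ⟨A, Y, hA, hval⟩ := exists_minRotEnergy_eq hφ hψ
  have hpi := Real.pi_pos
  have hmem : -(Real.pi / 2) ∈ Icc (-Real.pi) Real.pi := ⟨by linarith, by linarith⟩
  have hv0 : minRotEnergy φ ψ 0 = -(1 / 2) * (1 / 8 * A + Y) := by simp [hval]
  have hv1 : minRotEnergy φ ψ (-(Real.pi / 2)) = -(1 / 2) * (1 / 4 * A + Y) := by simp [hval]
  -- The difference of the two sides is `A cos² θ / 16`.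
  have hlow : ∀ θ, minRotEnergy φ ψ (-(Real.pi / 2)) ≤ minRotEnergy φ ψ θ := fun θ => by
    rw [hv1, hval]
    nlinarith [Real.sin_sq_add_cos_sq θ, mul_nonneg hA.le (sq_nonneg (Real.cos θ))]
  refine ⟨exists_isArgmin_of_isLeast (hmin 0),
    exists_isArgmin_of_isLeast (hmin (-(Real.pi / 2))), fun u₀ u₁ h₀ h₁ => ?_⟩
  rw [h₀.eq_of_isLeast (hmin 0), h₁.eq_of_isLeast (hmin (-(Real.pi / 2)))]
  refine ⟨fun θ _ => ?_, ⟨?_, ?_⟩, ⟨⟨_, hmem, hmin _⟩, ?_⟩, ?_, ?_⟩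
  -- The constant `Y` is distributed by `sin² + cos² = 1`.
  · have e : minRotEnergy φ ψ θ = Real.cos θ ^ 2 * minRotEnergy φ ψ 0 +
        Real.sin θ ^ 2 * minRotEnergy φ ψ (-(Real.pi / 2)) := by
      rw [hval, hv0, hv1]
      linear_combination (-(1 / 2) * Y) * (-Real.sin_sq_add_cos_sq θ)
    have := hmin θ
    rwa [e, EReal.coe_add, EReal.coe_mul, EReal.coe_mul] at this
  -- The equilibrium displacement for `θ = -π / 2` also minimizes the limit energy: its rotated
  -- energies are all at least the least minimum, which is reached at that angle.
  · have hu := displacement_mem_W1 hφ hψ (Real.cos (-(Real.pi / 2))) (Real.sin (-(Real.pi / 2)))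
    have h := limEnergy_of_mem hQ hφ hψ (hu 2) (m := minRotEnergy φ ψ (-(Real.pi / 2)))
      fun θ _ => (hlow θ).trans (minRotEnergy_le hφ hψ θ (hu 2))
    exact ⟨_, hu q, le_antisymm (h.2 _ hmem) h.1⟩
  · rintro _ ⟨v, -, rfl⟩
    by_cases hv : v ∈ W1 cyl 2
    · exact (limEnergy_of_mem hQ hφ hψ hv
        fun θ _ => (hlow θ).trans (minRotEnergy_le hφ hψ θ hv)).1
    · rw [limEnergy, if_neg hv]
      exact le_top
  · rintro m ⟨θ, -, hm⟩
    rw [hm.unique (hmin θ)]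
    exact EReal.coe_le_coe_iff.2 (hlow θ)
  · rw [EReal.coe_lt_coe_iff, hv0, hv1]
    linarith
  · rw [linEnergy_eq_rotEnergy hQ]
    exact hmin 0
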